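/- Let $q$ be a power of a prime, $r\ge 1$, and let $\mathbb{F}_{q^r}[X,\sigma]$ be the skew polynomial ring over $\mathbb{F}_{q^r}$ with $X\cdot a=\sigma(a)\cdot X$, where $\sigma(a)=a^q$. Call $P,Q\in\mathbb{F}_{q^r}[X,\sigma]$ similar if there is $U\in\mathbb{F}_{q^r}[X,\sigma]$ such that the right greatest common divisor of $U$ and $P$ is $1$ and $QU$ is the left lowest common multiple of $U$ and $P$ (up to a nonzero constant factor). For a monic $P=X^d-\sum_{i=0}^{d-1}a_iX^i$ let $D_P=\bigoplus_{i=0}^{d-1}\mathbb{F}_{q^r}e_i$ with the $\sigma$-semilinear map $\varphi$ given by $\varphi(e_i)=e_{i+1}$ for $0\le i\le d-2$ and $\varphi(e_{d-1})=\sum_{i=0}^{d-1}a_ie_i$. The map $\varphi^r$ is $\mathbb{F}_{q^r}$-linear, its characteristic polynomial has coefficients in $\mathbb{F}_q$, and one sets $\Psi(P)=\det(Y\,\mathrm{id}-\varphi^r)\in\mathbb{F}_q[Y]$. Then: (1) if $P,Q\in\mathbb{F}_{q^r}[X,\sigma]$ are monic and $P$ is irreducible, then $P$ and $Q$ are similar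 if and only if $\Psi(P)=\Psi(Q)$; (2) a monic $P\in\mathbb{F}_{q^r}[X,\sigma]$ is irreducible if and only if $\Psi(P)$ is irreducible in $\mathbb{F}_q[Y]$; (3) $\Psi$ maps the set of monic polynomials of $\mathbb{F}_{q^r}[X,\sigma]$ onto the set of monic polynomials of $\mathbb{F}_q[Y]$. -/

import Mathlib

noncomputable section

/-- The action of `(ℕ, +)` on `K` in which `n` acts as the `n`-th iterate of `σ`. -/
@[reducible] def skewAction {K : Type*} [Field K] (σ : K →+* K) :
    MulSemiringAction (Multiplicative ℕ) K where
  smul n x := σ^[Multiplicative.toAdd n] x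
  one_smul _ := rfl
  mul_smul m n x :=
    Function.iterate_add_apply σ (Multiplicative.toAdd m) (Multiplicative.toAdd n) x
  smul_zero n := iterate_map_zero σ (Multiplicative.toAdd n)
  smul_add n x y := iterate_map_add σ (Multiplicative.toAdd n) x y
  smul_one n := iterate_map_one σ (Multiplicative.toAdd n)
  smul_mul n x y := iterate_map_mul σ (Multiplicative.toAdd n) x y

/-- The skew polynomial ring `K[X, σ]`, with `X * a = σ a * X`. -/
def SkewPoly {K : Type*} [Field K] (_σ : K →+* K) : Type _ := SkewPolynomial K

namespace SkewPoly

variable {K : Type*} [Field K] {σ : K →+* K}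

instance : Ring (SkewPoly σ) :=
  letI := skewAction σ
  inferInstanceAs (Ring (SkewPolynomial K))

/-- The coefficient of `X ^ n` (coefficients are written on the left). -/
def coeff (P : SkewPoly σ) (n : ℕ) : K := SkewPolynomial.coeff P n

/-- The monomial `a * X ^ n`. -/
def monomial (σ : K →+* K) (n : ℕ) (a : K) : SkewPoly σ := SkewPolynomial.monomial n a

theorem monomial_mul_monomial (m n : ℕ) (a b : K) :
    monomial σ m a * monomial σ n b = monomial σ (m + n) (a * σ^[m] b) := by
  let := skewAction σ
  exact SkewPolynomial.monomial_mul_monomial m n a b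

/-- The degree (with value `0` at the zero polynomial). -/
def natDegree (P : SkewPoly σ) : ℕ := (SkewPolynomial.support P).sup id

/-- `P` has leading coefficient `1`. -/
def Monic (P : SkewPoly σ) : Prop := P.coeff P.natDegree = 1

/-- `P` divides `Q` on the right, i.e. `Q` is a left-multiple of `P`. -/
def RightDvd (P Q : SkewPoly σ) : Prop := ∃ U : SkewPoly σ, Q = U * P

/-- `D` is a right greatest common divisor of `P` and `Q`. -/
structure IsRGCD (D P Q : SkewPoly σ) : Prop where
  left : RightDvd D P
  right : RightDvd D Q
  greatest : ∀ E : SkewPoly σ, RightDvd E P → RightDvd E Q → RightDvd E D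

/-- `M` is a left lowest common multiple of `P` and `Q`. -/
structure IsLLCM (M P Q : SkewPoly σ) : Prop where
  left : RightDvd P M
  right : RightDvd Q M
  lowest : ∀ N : SkewPoly σ, RightDvd P N → RightDvd Q N → RightDvd M N

/-- `P` and `Q` are similar: for some `U`, the right gcd of `U` and `P` is `1` and `Q * U` is the
left lcm of `U` and `P`. -/
def Similar (P Q : SkewPoly σ) : Prop :=
  ∃ U : SkewPoly σ, IsRGCD 1 U P ∧ IsLLCM (Q * U) U P

/-- The underlying space of the `φ`-module `D_P`, with canonical basis `e_0, …, e_{d-1}`,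
where `d` is the degree of `P`. -/
abbrev Mod (P : SkewPoly σ) : Type _ := Fin P.natDegree → K

/-- The companion matrix of a monic `P = X ^ d - ∑ i < d, a_i X ^ i` (so `a_i = -coeff P i`). -/
def companion (P : SkewPoly σ) : Matrix (Fin P.natDegree) (Fin P.natDegree) K :=
  Matrix.of fun i j =>
    if (j : ℕ) + 1 = P.natDegree then -P.coeff i else if (i : ℕ) = j + 1 then 1 else 0

/-- The `σ`-semilinear map `φ` of `D_P`, whose matrix in the canonical basis is the companion
matrix of `P`. -/
def phi (P : SkewPoly σ) : Mod P →ₛₗ[σ] Mod P where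
  toFun v := P.companion.mulVec fun i => σ (v i)
  map_add' v w := by
    rw [← Matrix.mulVec_add]; congr 1; ext i; simp
  map_smul' c v := by
    rw [← Matrix.mulVec_smul]; congr 1; ext i; simp

/-- `φ(e_i) = e_{i+1}` for `i ≤ d - 2`. -/
theorem phi_single_of_lt (P : SkewPoly σ) (i : ℕ) (h : i + 1 < P.natDegree) :
    P.phi (Pi.single ⟨i, by omega⟩ 1) = Pi.single ⟨i + 1, h⟩ 1 := by
  have : (fun k => σ ((Pi.single ⟨i, by omega⟩ 1 : Mod P) k)) = Pi.single ⟨i, by omega⟩ 1 := by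
    ext k; by_cases hk : k = ⟨i, by omega⟩ <;> simp [hk]
  ext k
  change P.companion.mulVec _ k = _
  rw [this, Matrix.mulVec_single_one]
  simp only [companion, Matrix.col_apply, Matrix.of_apply, Pi.single_apply, Fin.ext_iff]
  rw [if_neg h.ne]

/-- `φ(e_{d-1}) = ∑ a_i e_i`. -/
theorem phi_single_last (P : SkewPoly σ) (i : ℕ) (h : i + 1 = P.natDegree) :
    P.phi (Pi.single ⟨i, by omega⟩ 1) = fun k : Fin P.natDegree => -P.coeff k := by
  have : (fun k => σ ((Pi.single ⟨i, by omega⟩ 1 : Mod P) k)) = Pi.single ⟨i, by omega⟩ 1 := by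
    ext k; by_cases hk : k = ⟨i, by omega⟩ <;> simp [hk]
  ext k
  change P.companion.mulVec _ k = _
  rw [this, Matrix.mulVec_single_one]
  simp [companion, h]

/-- The matrix `Γ σ(Γ) ⋯ σ^{n-1}(Γ)` of `φ ^ n`, where `Γ` is the companion matrix. -/
def phiMatrix (P : SkewPoly σ) : ℕ → Matrix (Fin P.natDegree) (Fin P.natDegree) K
  | 0 => 1
  | n + 1 => P.companion * (P.phiMatrix n).map σ

theorem phi_iterate (P : SkewPoly σ) (n : ℕ) (v : Mod P) :
    P.phi^[n] v = (P.phiMatrix n).mulVec fun i => σ^[n] (v i) := by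
  induction n with
  | zero => simp [phiMatrix]
  | succ n ih =>
    rw [Function.iterate_succ_apply', ih]
    change P.companion.mulVec _ = _
    rw [phiMatrix, ← Matrix.mulVec_mulVec]
    congr 1
    ext i
    rw [RingHom.map_mulVec]
    congr 1
    ext j
    exact (Function.iterate_succ_apply' σ n (v j)).symm

theorem phiMatrix_succ' (P : SkewPoly σ) (n : ℕ) :
    P.phiMatrix (n + 1) = P.phiMatrix n * P.companion.map σ^[n] := by
  induction n with
  | zero => ext; simp [phiMatrix, Matrix.map_one]
  | succ n ih =>
    have h : P.phiMatrix (n + 2) = P.companion * (P.phiMatrix (n + 1)).map σ := rfl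
    rw [h, ih, Matrix.map_mul, ← Matrix.mul_assoc, Matrix.map_map, ← Function.iterate_succ', ← ih]
    rfl

end SkewPoly

section FiniteFields

variable (F K : Type*) [Field F] [Fintype F] [Field K] [Algebra F K]

/-- The Frobenius `σ : x ↦ x ^ q` of `K`, where `q` is the cardinality of `F`. -/
def frobq : K →+* K := (FiniteField.frobeniusAlgHom F K : K →+* K)

theorem frobq_apply (x : K) : frobq F K x = x ^ Fintype.card F := rfl

theorem frobq_iterate_finrank [Finite K] (x : K) : (frobq F K)^[Module.finrank F K] x = x := by
  have := Fintype.ofFinite K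
  have h : ∀ n : ℕ, (frobq F K)^[n] x = x ^ (Fintype.card F) ^ n := by
    intro n
    induction n with
    | zero => simp
    | succ n ih => rw [Function.iterate_succ_apply', ih, frobq_apply, ← pow_mul, pow_succ]
  rw [h, ← Module.card_eq_pow_finrank (K := F) (V := K), FiniteField.pow_card]

theorem exists_algebraMap_of_frobq_eq (x : K) (hx : frobq F K x = x) :
    ∃ y : F, algebraMap F K y = x := by
  classical
  have h0 : (Polynomial.X ^ Fintype.card F - Polynomial.X : Polynomial K) ≠ 0 :=
    FiniteField.X_pow_card_sub_X_ne_zero K Fintype.one_lt_card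
  let S : Finset K := Finset.univ.image (algebraMap F K)
  let T : Finset K :=
    (Polynomial.X ^ Fintype.card F - Polynomial.X : Polynomial K).roots.toFinset
  have hST : S ⊆ T := by
    intro y hy
    obtain ⟨z, -, rfl⟩ := Finset.mem_image.1 hy
    rw [Multiset.mem_toFinset, Polynomial.mem_roots h0]
    simp [← map_pow, FiniteField.pow_card]
  have hcard : T.card ≤ S.card := by
    rw [Finset.card_image_of_injective _ (algebraMap F K).injective, Finset.card_univ]
    refine (Multiset.toFinset_card_le _).trans ((Polynomial.card_roots' _).trans ?_)
    rw [FiniteField.X_pow_card_sub_X_natDegree_eq K Fintype.one_lt_card]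
  have hxT : x ∈ T := by
    rw [Multiset.mem_toFinset, Polynomial.mem_roots h0]
    simp [← frobq_apply F K, hx]
  rw [← Finset.eq_of_subset_of_card_le hST hcard] at hxT
  obtain ⟨y, -, hy⟩ := Finset.mem_image.1 hxT
  exact ⟨y, hy⟩

variable {F K} [Finite K]

namespace SkewPoly

/-- The `K`-linear map `φ ^ r` of `D_P`, where `r = [K : F]`. -/
def phiPow (P : SkewPoly (frobq F K)) : Mod P →ₗ[K] Mod P where
  toFun := P.phi^[Module.finrank F K]
  map_add' v w := iterate_map_add P.phi _ v w
  map_smul' c v := by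
    simp only [phi_iterate, frobq_iterate_finrank]
    exact Matrix.mulVec_smul _ c v

/-- The characteristic polynomial of `φ ^ r` has coefficients in `F`. -/
theorem exists_map_eq_charpoly (P : SkewPoly (frobq F K)) :
    ∃ R : Polynomial F, R.map (algebraMap F K) = P.phiPow.charpoly := by
  obtain ⟨m, hm⟩ : ∃ m, Module.finrank F K = m + 1 :=
    ⟨_, (Nat.succ_pred_eq_of_pos Module.finrank_pos).symm⟩
  have hσ : (frobq F K)^[m + 1] = id := by
    rw [← hm]; exact funext (frobq_iterate_finrank F K)
  have h1 : P.phiPow = Matrix.toLin' (P.phiMatrix (m + 1)) := by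
    refine LinearMap.ext fun v => ?_
    change P.phi^[Module.finrank F K] v = (P.phiMatrix (m + 1)).mulVec v
    rw [hm, phi_iterate, hσ]
    rfl
  have h2 : (P.phiMatrix (m + 1)).map (frobq F K) =
      (P.phiMatrix m).map (frobq F K) * P.companion := by
    rw [phiMatrix_succ', Matrix.map_mul, Matrix.map_map, ← Function.iterate_succ', hσ]
    congr 1
  have h3 : (P.phiMatrix (m + 1)).charpoly.map (frobq F K) = (P.phiMatrix (m + 1)).charpoly := by
    rw [← Matrix.charpoly_map, h2, Matrix.charpoly_mul_comm]
    rfl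
  rw [h1, Matrix.charpoly_toLin']
  have h4 : (P.phiMatrix (m + 1)).charpoly ∈ Polynomial.lifts (algebraMap F K) := by
    rw [Polynomial.lifts_iff_coeff_lifts]
    intro n
    apply exists_algebraMap_of_frobq_eq F K
    conv_rhs => rw [← h3, Polynomial.coeff_map]
  exact (Polynomial.mem_lifts _).1 h4

/-- `Ψ(P) ∈ F[Y]` is the characteristic polynomial `det (Y id - φ ^ r)` of `φ ^ r` on `D_P`
(meaningful for monic `P`): the unique polynomial over `F` whose image over `K` is that
characteristic polynomial. -/
def Psi (P : SkewPoly (frobq F K)) : Polynomial F := P.exists_map_eq_charpoly.choose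

theorem map_Psi (P : SkewPoly (frobq F K)) :
    P.Psi.map (algebraMap F K) = P.phiPow.charpoly :=
  P.exists_map_eq_charpoly.choose_spec

end SkewPoly

end FiniteFields

end

/-! The φ-module `D_P` is the left module `Quo P` of skew polynomials modulo left multiples of P,
with φ acting as X (`toQuo_phi`). So everything becomes a statement about modules: P is irreducible
iff `Quo P` is simple (`isSimpleModule_quo_iff`), similarity is isomorphism
(`similar_iff_nonempty_quo_equiv`), and Ψ(P) is the characteristic polynomial of X^r, which is
central because σ^r = 1. Thus Ψ is an isomorphism invariant, and it is multiplicative by exact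
sequences (`Psi_mul`).

The core is a simple module M of dimension n over K on which X is injective. Let R, of degree d, be
the minimal polynomial of X^r over F, let T = R(X^r), and let E be the endomorphism ring of M, a
finite division ring and hence a field. Density, independence of the powers of Frobenius and descent
by the trace show that E consists of polynomials in X^r over F, so |E| ≤ q^d. With μ = dim_E M,
counting M gives rn ≤ dμ, and counting the surjection from `Quo T` onto End_E(M) gives nμ ≤ rd;
hence n ≤ d (`finrank_le_and_annihilator`). By Cayley-Hamilton R divides Ψ(P), which has degree n,
so R = Ψ(P). It is irreducible, being a minimal polynomial in a domain; conversely, multiplicativity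
makes P irreducible when Ψ(P) is.

When n = d the counts are equalities and T generates the annihilator of M. Then M is isomorphic to
every simple submodule of `Quo T`, so Ψ(P) determines M. For surjectivity, an irreducible R is
reached through a maximal left ideal containing R(X^r), and the general case follows by
multiplicativity. -/

noncomputable section

namespace SkewPoly

/-! ### Arithmetic of skew polynomials: degrees, right division, left ideals. -/

section Basic

variable {K : Type*} [Field K] {σ : K →+* K}

@[ext]
theorem ext {P Q : SkewPoly σ} (h : ∀ n, P.coeff n = Q.coeff n) : P = Q :=
  SkewPolynomial.ext h

@[simp]
theorem coeff_zero (n : ℕ) : (0 : SkewPoly σ).coeff n = 0 := rfl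

@[simp]
theorem coeff_add (P Q : SkewPoly σ) (n : ℕ) : (P + Q).coeff n = P.coeff n + Q.coeff n :=
  SkewPolynomial.coeff_add P Q n

@[simp]
theorem coeff_neg (P : SkewPoly σ) (n : ℕ) : (-P).coeff n = -P.coeff n :=
  SkewPolynomial.coeff_neg P n

@[simp]
theorem coeff_sub (P Q : SkewPoly σ) (n : ℕ) : (P - Q).coeff n = P.coeff n - Q.coeff n :=
  SkewPolynomial.coeff_sub P Q n

theorem coeff_monomial (m n : ℕ) (a : K) : (monomial σ m a).coeff n = if m = n then a else 0 :=
  SkewPolynomial.coeff_monomial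

theorem monomial_add (n : ℕ) (a b : K) :
    monomial σ n (a + b) = monomial σ n a + monomial σ n b :=
  SkewPolynomial.monomial_add n a b

@[simp]
theorem monomial_zero_right (n : ℕ) : monomial σ n 0 = 0 := by
  ext k; simp [coeff_monomial]

theorem one_def : (1 : SkewPoly σ) = monomial σ 0 1 := rfl

theorem coeff_one (n : ℕ) : (1 : SkewPoly σ).coeff n = if 0 = n then 1 else 0 := by
  rw [one_def, coeff_monomial]

/-- Taking a coefficient, as an additive map. -/
def coeffHom (σ : K →+* K) (n : ℕ) : SkewPoly σ →+ K where
  toFun P := P.coeff n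
  map_zero' := rfl
  map_add' P Q := coeff_add P Q n

theorem coeff_sum {ι : Type*} (s : Finset ι) (f : ι → SkewPoly σ) (n : ℕ) :
    (∑ i ∈ s, f i).coeff n = ∑ i ∈ s, (f i).coeff n :=
  map_sum (coeffHom σ n) f s

theorem coeff_eq_zero_of_natDegree_lt {P : SkewPoly σ} {n : ℕ} (h : P.natDegree < n) :
    P.coeff n = 0 := by
  by_contra hn
  have : n ∈ SkewPolynomial.support P := SkewPolynomial.mem_support_iff.2 hn
  exact absurd (Finset.le_sup (f := id) this) (not_le.2 h)

theorem natDegree_le_iff {P : SkewPoly σ} {n : ℕ} :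
    P.natDegree ≤ n ↔ ∀ k, n < k → P.coeff k = 0 := by
  refine ⟨fun h k hk => coeff_eq_zero_of_natDegree_lt (h.trans_lt hk), fun h => ?_⟩
  refine Finset.sup_le fun k hk => ?_
  by_contra hkn
  exact SkewPolynomial.mem_support_iff.1 hk (h k (not_le.1 hkn))

theorem eq_sum_monomial {P : SkewPoly σ} {n : ℕ} (h : P.natDegree < n) :
    P = ∑ i ∈ Finset.range n, monomial σ i (P.coeff i) := by
  ext k
  simp only [coeff_sum, coeff_monomial, Finset.sum_ite_eq', Finset.mem_range]
  split_ifs with hk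
  · rfl
  · exact coeff_eq_zero_of_natDegree_lt (by omega)

theorem induction_monomial {p : SkewPoly σ → Prop} (P : SkewPoly σ) (h0 : p 0)
    (hadd : ∀ P Q, p P → p Q → p (P + Q)) (hmon : ∀ n a, p (monomial σ n a)) : p P := by
  rw [eq_sum_monomial (Nat.lt_succ_self P.natDegree)]
  exact Finset.sum_induction _ p hadd h0 fun i _ => hmon i _

theorem coeff_mul (P Q : SkewPoly σ) (n : ℕ) :
    (P * Q).coeff n =
      ∑ ij ∈ Finset.HasAntidiagonal.antidiagonal n, P.coeff ij.1 * σ^[ij.1] (Q.coeff ij.2) := by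
  induction P using induction_monomial with
  | h0 => simp
  | hadd P P' hP hP' => simp [add_mul, hP, hP', Finset.sum_add_distrib]
  | hmon i a =>
    induction Q using induction_monomial with
    | h0 => simp
    | hadd Q Q' hQ hQ' => simp [mul_add, hQ, hQ', Finset.sum_add_distrib, iterate_map_add]
    | hmon j b =>
      rw [monomial_mul_monomial, coeff_monomial]
      split_ifs with h
      · rw [Finset.sum_eq_single_of_mem (i, j) (by simpa using h)]
        · simp [coeff_monomial]
        · rintro ⟨i', j'⟩ - hne
          simp only [coeff_monomial]
          by_cases hi : i = i'
          · have hj : j ≠ j' := by rintro rfl; exact hne (by rw [hi])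
            simp [hj]
          · simp [hi]
      · symm
        refine Finset.sum_eq_zero ?_
        rintro ⟨i', j'⟩ hij
        simp only [Finset.HasAntidiagonal.mem_antidiagonal] at hij
        simp only [coeff_monomial]
        by_cases hi : i = i'
        · have hj : j ≠ j' := by rintro rfl; exact h (by rw [hi, hij])
          simp [hj]
        · simp [hi]

theorem natDegree_mul_le (P Q : SkewPoly σ) : (P * Q).natDegree ≤ P.natDegree + Q.natDegree := by
  rw [natDegree_le_iff]
  intro k hk
  rw [coeff_mul]
  refine Finset.sum_eq_zero ?_
  rintro ⟨i, j⟩ hij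
  simp only [Finset.HasAntidiagonal.mem_antidiagonal] at hij
  rcases lt_or_ge P.natDegree i with hi | hi
  · simp [coeff_eq_zero_of_natDegree_lt hi]
  · simp [coeff_eq_zero_of_natDegree_lt (show Q.natDegree < j by omega)]

theorem coeff_mul_natDegree_add (P Q : SkewPoly σ) :
    (P * Q).coeff (P.natDegree + Q.natDegree) =
      P.coeff P.natDegree * σ^[P.natDegree] (Q.coeff Q.natDegree) := by
  rw [coeff_mul, Finset.sum_eq_single_of_mem (P.natDegree, Q.natDegree) (by simp)]
  rintro ⟨i, j⟩ hij hne
  simp only [Finset.HasAntidiagonal.mem_antidiagonal] at hij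
  rcases lt_trichotomy P.natDegree i with hi | hi | hi
  · simp [coeff_eq_zero_of_natDegree_lt hi]
  · exact absurd (by ext <;> simp <;> omega) hne
  · simp [coeff_eq_zero_of_natDegree_lt (show Q.natDegree < j by omega)]

theorem coeff_natDegree_ne_zero {P : SkewPoly σ} (h : P ≠ 0) : P.coeff P.natDegree ≠ 0 := by
  intro h0
  have hne : (SkewPolynomial.support P).Nonempty := by
    rw [Finset.nonempty_iff_ne_empty]
    exact fun he => h (SkewPolynomial.support_eq_empty.1 he)
  obtain ⟨n, hn, hn'⟩ := Finset.exists_mem_eq_sup _ hne (id : ℕ → ℕ)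
  have : P.natDegree = n := hn'
  exact SkewPolynomial.mem_support_iff.1 hn (this ▸ h0)

theorem le_natDegree_of_ne_zero {P : SkewPoly σ} {n : ℕ} (h : P.coeff n ≠ 0) :
    n ≤ P.natDegree :=
  not_lt.1 fun hn => h (coeff_eq_zero_of_natDegree_lt hn)

theorem coeff_mul_ne_zero {P Q : SkewPoly σ} (hP : P ≠ 0) (hQ : Q ≠ 0) :
    (P * Q).coeff (P.natDegree + Q.natDegree) ≠ 0 := by
  rw [coeff_mul_natDegree_add]
  refine mul_ne_zero (coeff_natDegree_ne_zero hP) ?_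
  rw [← RingHom.coe_pow, Ne, map_eq_zero]
  exact coeff_natDegree_ne_zero hQ

instance : Nontrivial (SkewPoly σ) :=
  ⟨0, 1, fun h => by simpa [coeff_one] using congrArg (fun P => P.coeff 0) h⟩

instance : NoZeroDivisors (SkewPoly σ) where
  eq_zero_or_eq_zero_of_mul_eq_zero {P Q} h := by
    by_contra! hne
    exact coeff_mul_ne_zero hne.1 hne.2 (by rw [h, coeff_zero])

instance : IsDomain (SkewPoly σ) := NoZeroDivisors.to_isDomain _

theorem natDegree_mul {P Q : SkewPoly σ} (hP : P ≠ 0) (hQ : Q ≠ 0) :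
    (P * Q).natDegree = P.natDegree + Q.natDegree :=
  le_antisymm (natDegree_mul_le P Q) (le_natDegree_of_ne_zero (coeff_mul_ne_zero hP hQ))

theorem Monic.ne_zero {P : SkewPoly σ} (h : P.Monic) : P ≠ 0 := by
  rintro rfl
  exact zero_ne_one h

theorem Monic.mul {P Q : SkewPoly σ} (hP : P.Monic) (hQ : Q.Monic) : (P * Q).Monic := by
  rw [Monic, natDegree_mul hP.ne_zero hQ.ne_zero, coeff_mul_natDegree_add, hP, hQ]
  simp

theorem Monic.of_mul_right {P Q : SkewPoly σ} (hPQ : (P * Q).Monic) (hQ : Q.Monic) : P.Monic := by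
  have hP : P ≠ 0 := by rintro rfl; exact hPQ.ne_zero (zero_mul _)
  rw [Monic, natDegree_mul hP hQ.ne_zero, coeff_mul_natDegree_add, hQ] at hPQ
  exact (by simpa using hPQ : P.coeff P.natDegree = 1)

/-- The constant polynomials. -/
def C (σ : K →+* K) : K →+* SkewPoly σ where
  toFun a := monomial σ 0 a
  map_one' := rfl
  map_mul' a b := by simp [monomial_mul_monomial]
  map_zero' := monomial_zero_right 0
  map_add' a b := monomial_add 0 a b

theorem C_apply (a : K) : C σ a = monomial σ 0 a := rfl

/-- The variable. -/
def X (σ : K →+* K) : SkewPoly σ := monomial σ 1 1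

theorem X_pow (n : ℕ) : X σ ^ n = monomial σ n 1 := by
  induction n with
  | zero => rfl
  | succ n ih => rw [pow_succ, ih, X, monomial_mul_monomial]; simp

theorem C_mul_X_pow (n : ℕ) (a : K) : C σ a * X σ ^ n = monomial σ n a := by
  simp [C_apply, X_pow, monomial_mul_monomial]

theorem X_pow_mul_C (n : ℕ) (a : K) : X σ ^ n * C σ a = C σ (σ^[n] a) * X σ ^ n := by
  simp [C_apply, X_pow, monomial_mul_monomial]

theorem X_mul_C (a : K) : X σ * C σ a = C σ (σ a) * X σ := by
  simpa using X_pow_mul_C (σ := σ) 1 a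

theorem coeff_C_mul (a : K) (P : SkewPoly σ) (n : ℕ) : (C σ a * P).coeff n = a * P.coeff n := by
  rw [coeff_mul, Finset.sum_eq_single_of_mem (0, n) (by simp)]
  · simp [C_apply, coeff_monomial]
  · rintro ⟨i, j⟩ hij hne
    have hi : 0 ≠ i := by
      rintro rfl
      exact hne (by simpa using hij)
    simp [C_apply, coeff_monomial, hi]

theorem natDegree_C (a : K) : (C σ a).natDegree = 0 := by
  rw [← Nat.le_zero, natDegree_le_iff]
  intro k hk
  simp [C_apply, coeff_monomial, hk.ne]

theorem eq_C_of_natDegree_eq_zero {P : SkewPoly σ} (h : P.natDegree = 0) :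
    P = C σ (P.coeff 0) := by
  conv_lhs => rw [eq_sum_monomial (P := P) (n := 1) (by omega)]
  simp [C_apply]

theorem isUnit_iff_natDegree_eq_zero {P : SkewPoly σ} (hP : P ≠ 0) :
    IsUnit P ↔ P.natDegree = 0 := by
  constructor
  · intro h
    obtain ⟨Q, hQ⟩ := h.exists_right_inv
    have hQ0 : Q ≠ 0 := by rintro rfl; simp at hQ
    have := natDegree_mul hP hQ0
    rw [hQ, one_def, ← C_apply, natDegree_C] at this
    omega
  · intro h
    have h1 := eq_C_of_natDegree_eq_zero h
    have h2 := coeff_natDegree_ne_zero hP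
    rw [h] at h2
    rw [h1]
    exact (isUnit_iff_ne_zero.2 h2).map (C σ)

theorem Monic.eq_one_of_isUnit {P : SkewPoly σ} (hP : P.Monic) (h : IsUnit P) : P = 1 := by
  have h0 := (isUnit_iff_natDegree_eq_zero hP.ne_zero).1 h
  rw [Monic, h0] at hP
  rw [eq_C_of_natDegree_eq_zero h0, hP, map_one]

/-- Every nonzero polynomial becomes monic after multiplication by a constant. -/
theorem exists_monic_C_mul {P : SkewPoly σ} (hP : P ≠ 0) : ∃ a : K, a ≠ 0 ∧ (C σ a * P).Monic := by
  have h := coeff_natDegree_ne_zero hP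
  refine ⟨(P.coeff P.natDegree)⁻¹, inv_ne_zero h, ?_⟩
  have hC : C σ (P.coeff P.natDegree)⁻¹ ≠ 0 := by
    simpa using inv_ne_zero h
  rw [Monic, natDegree_mul hC hP, natDegree_C, zero_add, coeff_C_mul, inv_mul_cancel₀ h]

/-- Right Euclidean division by a monic polynomial. -/
theorem exists_eq_mul_add {P : SkewPoly σ} (hP : P.Monic) (f : SkewPoly σ) :
    ∃ g h : SkewPoly σ, f = g * P + h ∧ ∀ k, P.natDegree ≤ k → h.coeff k = 0 := by
  suffices ∀ n, ∀ f : SkewPoly σ, f.natDegree < n → ∃ g h : SkewPoly σ, f = g * P + h ∧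
      ∀ k, P.natDegree ≤ k → h.coeff k = 0 from this _ f (Nat.lt_succ_self _)
  intro n
  induction n with
  | zero => intro f hf; omega
  | succ n ih =>
    intro f hf
    rcases lt_or_ge f.natDegree P.natDegree with hlt | hge
    · exact ⟨0, f, by simp, fun k hk => coeff_eq_zero_of_natDegree_lt (hlt.trans_le hk)⟩
    · set m := f.natDegree - P.natDegree with hm
      set q := monomial σ m (f.coeff f.natDegree) with hq
      have hqdeg : q.natDegree ≤ m := by
        rw [natDegree_le_iff]
        intro k hk
        simp [hq, coeff_monomial, hk.ne]
      have hle : (f - q * P).natDegree ≤ f.natDegree := by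
        rw [natDegree_le_iff]
        intro k hk
        have := natDegree_mul_le q P
        rw [coeff_sub, coeff_eq_zero_of_natDegree_lt hk,
          coeff_eq_zero_of_natDegree_lt (P := q * P) (by omega), sub_zero]
      have htop : (f - q * P).coeff f.natDegree = 0 := by
        rw [coeff_sub, coeff_mul, Finset.sum_eq_single_of_mem (m, P.natDegree)
          (by simp; omega)]
        · rw [show P.coeff P.natDegree = 1 from hP]
          simp [hq, coeff_monomial]
        · rintro ⟨i, j⟩ hij hne
          simp only [Finset.HasAntidiagonal.mem_antidiagonal] at hij
          have hi : m ≠ i := by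
            rintro rfl
            exact hne (by ext <;> simp; omega)
          simp [hq, coeff_monomial, hi]
      by_cases h0 : f - q * P = 0
      -- Zero is treated apart: its `natDegree` is 0, which does not drop when f is a constant.
      · exact ⟨q, 0, by rw [add_zero, ← sub_eq_zero, h0], fun k _ => rfl⟩
      have hlt : (f - q * P).natDegree < f.natDegree := by
        refine lt_of_le_of_ne hle fun he => coeff_natDegree_ne_zero h0 ?_
        rw [he, htop]
      obtain ⟨g, h, hgh, hh⟩ := ih (f - q * P) (by omega)
      exact ⟨q + g, h, by rw [add_mul, add_assoc, ← hgh]; abel, hh⟩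

theorem eq_zero_of_mul_natDegree_lt {P g : SkewPoly σ} (hP : P ≠ 0)
    (h : ∀ k, P.natDegree ≤ k → (g * P).coeff k = 0) : g = 0 := by
  by_contra hg
  exact coeff_mul_ne_zero hg hP (h _ (by omega))

/-- Every left ideal is generated by `0` or by a monic polynomial. -/
theorem exists_monic_span {I : Submodule (SkewPoly σ) (SkewPoly σ)} (hI : I ≠ ⊥) :
    ∃ P : SkewPoly σ, P.Monic ∧ I = Submodule.span (SkewPoly σ) {P} := by
  obtain ⟨f, hf, hf0⟩ := Submodule.exists_mem_ne_zero_of_ne_bot hI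
  classical
  have hex : ∃ n, ∃ f : SkewPoly σ, f ∈ I ∧ f ≠ 0 ∧ f.natDegree = n := ⟨_, f, hf, hf0, rfl⟩
  obtain ⟨P, hPI, hP0, hPn⟩ := Nat.find_spec hex
  have hmin : ∀ f ∈ I, f ≠ 0 → P.natDegree ≤ f.natDegree := fun f hf hf0 => by
    rw [hPn]; exact Nat.find_min' hex ⟨f, hf, hf0, rfl⟩
  obtain ⟨a, ha, hmon⟩ := exists_monic_C_mul hP0
  have hC : C σ a ≠ 0 := by simpa using ha
  have hdeg : (C σ a * P).natDegree = P.natDegree := by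
    rw [natDegree_mul hC hP0, natDegree_C, zero_add]
  have haI : C σ a * P ∈ I := I.smul_mem (C σ a) hPI
  refine ⟨_, hmon, le_antisymm (fun f hf => ?_) ?_⟩
  · obtain ⟨g, h, hgh, hh⟩ := exists_eq_mul_add hmon f
    have hhI : h ∈ I := by
      have : h = f - g * (C σ a * P) := by rw [hgh]; abel
      rw [this]
      exact I.sub_mem hf (I.smul_mem g haI)
    have hh0 : h = 0 := by
      by_contra hne
      exact coeff_natDegree_ne_zero hne (hh _ (hdeg ▸ hmin h hhI hne))
    rw [hgh, hh0, add_zero]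
    exact Submodule.mem_span_singleton.2 ⟨g, rfl⟩
  · rw [Submodule.span_singleton_le_iff_mem]
    exact haI

theorem mem_span_singleton_iff {P f : SkewPoly σ} :
    f ∈ Submodule.span (SkewPoly σ) {P} ↔ ∃ g, f = g * P := by
  rw [Submodule.mem_span_singleton]
  exact exists_congr fun g => eq_comm

end Basic

/-! ### The φ-module as a quotient of the skew polynomial ring. -/

section Module

variable {K : Type*} [Field K] {σ : K →+* K}

instance : Module K (SkewPoly σ) := Module.compHom _ (C σ)

theorem smul_eq_C_mul (a : K) (P : SkewPoly σ) : a • P = C σ a * P := rfl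

instance : IsScalarTower K (SkewPoly σ) (SkewPoly σ) where
  smul_assoc a P Q := mul_assoc (C σ a) P Q

/-- The quotient of the skew polynomial ring by the left ideal generated by `P`. -/
abbrev Quo (P : SkewPoly σ) : Type _ := SkewPoly σ ⧸ Submodule.span (SkewPoly σ) {P}

variable {M : Type*} [AddCommGroup M] [Module (SkewPoly σ) M] [Module K M]
  [IsScalarTower K (SkewPoly σ) M]

theorem C_smul (a : K) (m : M) : C σ a • m = a • m := by
  rw [← mul_one (C σ a), ← smul_eq_C_mul, smul_assoc, one_smul]

theorem X_pow_smul_smul (n : ℕ) (a : K) (m : M) :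
    X σ ^ n • a • m = σ^[n] a • X σ ^ n • m := by
  rw [← C_smul (σ := σ), ← C_smul (σ := σ), smul_smul, smul_smul, X_pow_mul_C]

theorem X_smul_smul (a : K) (m : M) : X σ • a • m = σ a • X σ • m := by
  rw [← C_smul (σ := σ), ← C_smul (σ := σ), smul_smul, smul_smul, X_mul_C]

theorem monomial_smul (n : ℕ) (a : K) (m : M) : monomial σ n a • m = a • X σ ^ n • m := by
  rw [← C_mul_X_pow, mul_smul, C_smul]

theorem natDegree_X_pow (n : ℕ) : (X σ ^ n).natDegree = n := by
  refine le_antisymm ?_ (le_natDegree_of_ne_zero ?_)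
  · rw [natDegree_le_iff]
    intro k hk
    simp [X_pow, coeff_monomial, hk.ne]
  · simp [X_pow, coeff_monomial]

/-- The class in `Quo P` of the polynomial of degree `< deg P` with the given coefficients. -/
def toQuo (P : SkewPoly σ) : Mod P →ₗ[K] Quo P where
  toFun v := Submodule.Quotient.mk (∑ i : Fin P.natDegree, monomial σ i (v i))
  map_add' v w := by
    simp [monomial_add, Finset.sum_add_distrib]
  map_smul' a v := by
    rw [RingHom.id_apply, ← Submodule.Quotient.mk_smul, Finset.smul_sum]
    congr 2
    ext i : 1
    simp [smul_eq_C_mul, C_apply, monomial_mul_monomial]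

theorem toQuo_apply (P : SkewPoly σ) (v : Mod P) :
    toQuo P v = Submodule.Quotient.mk (∑ i : Fin P.natDegree, monomial σ i (v i)) := rfl

theorem coeff_sum_monomial {n : ℕ} (v : Fin n → K) (k : ℕ) :
    (∑ i : Fin n, monomial σ i (v i)).coeff k = if h : k < n then v ⟨k, h⟩ else 0 := by
  rw [coeff_sum]
  simp only [coeff_monomial]
  split_ifs with h
  · rw [Finset.sum_eq_single_of_mem (⟨k, h⟩ : Fin n) (Finset.mem_univ _)]
    · simp
    · intro i _ hi
      exact if_neg fun hik => hi (Fin.ext hik)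
  · refine Finset.sum_eq_zero fun i _ => if_neg fun (hik : (i : ℕ) = k) => h (hik ▸ i.2)

/-- Remainders under right division by P are unique and always exist: a nonzero multiple of P has
degree at least that of P. -/
theorem toQuo_bijective {P : SkewPoly σ} (hP : P.Monic) : Function.Bijective (toQuo P) := by
  constructor
  · rw [injective_iff_map_eq_zero]
    intro v hv
    rw [toQuo_apply, Submodule.Quotient.mk_eq_zero, mem_span_singleton_iff] at hv
    obtain ⟨g, hg⟩ := hv
    have hg0 : g = 0 := by
      refine eq_zero_of_mul_natDegree_lt hP.ne_zero fun k hk => ?_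
      rw [← hg, coeff_sum_monomial, dif_neg (by omega)]
    rw [hg0, zero_mul] at hg
    ext i
    have := coeff_sum_monomial (σ := σ) v i
    rw [hg] at this
    simpa using this.symm
  · intro q
    obtain ⟨f, rfl⟩ := Submodule.Quotient.mk_surjective _ q
    obtain ⟨g, h, hgh, hh⟩ := exists_eq_mul_add hP f
    refine ⟨fun i => h.coeff i, ?_⟩
    rw [toQuo_apply, Submodule.Quotient.eq]
    have : ∑ i : Fin P.natDegree, monomial σ i (h.coeff i) = h := by
      ext k
      rw [coeff_sum_monomial]
      split_ifs with hk
      · rfl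
      · exact (hh k (not_lt.1 hk)).symm
    rw [this, hgh, mem_span_singleton_iff]
    exact ⟨-g, by rw [neg_mul]; abel⟩

theorem mk_self (P : SkewPoly σ) : (Submodule.Quotient.mk P : Quo P) = 0 :=
  (Submodule.Quotient.mk_eq_zero _).2 (Submodule.mem_span_singleton_self P)

theorem toQuo_single (P : SkewPoly σ) (i : Fin P.natDegree) :
    toQuo P (Pi.single i 1) = Submodule.Quotient.mk (X σ ^ (i : ℕ)) := by
  rw [toQuo_apply]
  rw [Finset.sum_eq_single_of_mem i (Finset.mem_univ _)]
  · simp [X_pow]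
  · intro j _ hj
    simp [hj]

/-- Both sides are σ-semilinear, so basis vectors suffice. Only the last one involves P: there the
two sides differ by a multiple of P itself. -/
theorem toQuo_phi {P : SkewPoly σ} (hP : P.Monic) (v : Mod P) :
    toQuo P (P.phi v) = X σ • toQuo P v := by
  have hv : v = ∑ i, v i • (Pi.single i 1 : Mod P) := by
    ext k
    simp [Pi.single_apply]
  rw [hv, map_sum, map_sum, map_sum, Finset.smul_sum]
  refine Finset.sum_congr rfl fun i _ => ?_
  rw [map_smulₛₗ, map_smul, map_smul, X_smul_smul]
  congr 1
  rw [toQuo_single, ← Submodule.Quotient.mk_smul, smul_eq_mul, ← pow_succ']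
  rcases Nat.lt_or_ge (i + 1) P.natDegree with h | h
  · have := P.phi_single_of_lt i h
    rw [Fin.eta] at this
    rw [this, toQuo_single]
  · have h' : (i : ℕ) + 1 = P.natDegree := by omega
    have := P.phi_single_last i h'
    rw [Fin.eta] at this
    rw [this, h', toQuo_apply, Submodule.Quotient.eq, mem_span_singleton_iff]
    refine ⟨-1, ?_⟩
    rw [neg_one_mul]
    ext k
    rw [coeff_sub, coeff_neg, X_pow, coeff_monomial, coeff_sum_monomial]
    rcases lt_trichotomy k P.natDegree with hk | hk | hk
    · simp [hk, hk.ne']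
    · subst hk
      simp [show P.coeff P.natDegree = 1 from hP]
    · simp [hk.not_gt, hk.ne, coeff_eq_zero_of_natDegree_lt hk]

/-- The `φ`-module `D_P` is the quotient by the left ideal generated by `P`. -/
def quoEquiv {P : SkewPoly σ} (hP : P.Monic) : Mod P ≃ₗ[K] Quo P :=
  LinearEquiv.ofBijective (toQuo P) (toQuo_bijective hP)

theorem finite_quo {P : SkewPoly σ} (hP : P.Monic) : Module.Finite K (Quo P) :=
  Module.Finite.equiv (quoEquiv hP)

theorem finrank_quo {P : SkewPoly σ} (hP : P.Monic) : Module.finrank K (Quo P) = P.natDegree := by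
  rw [← (quoEquiv hP).finrank_eq, Module.finrank_fin_fun]

end Module

/-! ### The central elements g(X^r), and Ψ as a characteristic polynomial of X^r. -/

section FiniteFields

variable {F K : Type*} [Field F] [Fintype F] [Field K] [Algebra F K]

theorem frobq_algebraMap (c : F) : frobq F K (algebraMap F K c) = algebraMap F K c := by
  rw [frobq_apply, ← map_pow, FiniteField.pow_card]

theorem frobq_iterate_algebraMap (n : ℕ) (c : F) :
    (frobq F K)^[n] (algebraMap F K c) = algebraMap F K c :=
  Function.iterate_fixed (frobq_algebraMap c) n

theorem C_algebraMap_comm (c : F) (P : SkewPoly (frobq F K)) :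
    C (frobq F K) (algebraMap F K c) * P = P * C (frobq F K) (algebraMap F K c) := by
  induction P using induction_monomial with
  | h0 => simp
  | hadd P Q hP hQ => rw [mul_add, add_mul, hP, hQ]
  | hmon n a =>
    rw [C_apply, monomial_mul_monomial, monomial_mul_monomial, frobq_iterate_algebraMap,
      add_comm n 0, mul_comm a]
    rfl

instance : Algebra F (SkewPoly (frobq F K)) :=
  RingHom.toAlgebra' ((C (frobq F K)).comp (algebraMap F K)) C_algebraMap_comm

theorem algebraMap_eq (c : F) :
    algebraMap F (SkewPoly (frobq F K)) c = C (frobq F K) (algebraMap F K c) := rfl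

instance : IsScalarTower F K (SkewPoly (frobq F K)) where
  smul_assoc c a P := by
    rw [Algebra.smul_def (R := F) (A := SkewPoly (frobq F K)), smul_eq_C_mul, smul_eq_C_mul,
      Algebra.smul_def, map_mul, mul_assoc]
    rfl

theorem aeval_X_pow_eq_sum (g : Polynomial F) :
    Polynomial.aeval (X (frobq F K) ^ Module.finrank F K) g =
      ∑ i ∈ Finset.range (g.natDegree + 1), monomial (frobq F K) (Module.finrank F K * i)
        (algebraMap F K (g.coeff i)) := by
  rw [Polynomial.aeval_eq_sum_range]
  refine Finset.sum_congr rfl fun i _ => ?_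
  rw [Algebra.smul_def, algebraMap_eq, ← pow_mul, C_mul_X_pow]

variable [Finite K]

/-- X^r commutes with constants because the r-th power of Frobenius is the identity on K. -/
theorem X_pow_finrank_comm (P : SkewPoly (frobq F K)) :
    X (frobq F K) ^ Module.finrank F K * P = P * X (frobq F K) ^ Module.finrank F K := by
  induction P using induction_monomial with
  | h0 => simp
  | hadd P Q hP hQ => rw [mul_add, add_mul, hP, hQ]
  | hmon n a =>
    rw [X_pow, monomial_mul_monomial, monomial_mul_monomial, frobq_iterate_finrank,
      add_comm, iterate_map_one, one_mul, mul_one]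

theorem commute_aeval_X_pow (g : Polynomial F) (P : SkewPoly (frobq F K)) :
    Commute (Polynomial.aeval (X (frobq F K) ^ Module.finrank F K) g) P := by
  induction g using Polynomial.induction_on' with
  | add g h hg hh => rw [map_add]; exact hg.add_left hh
  | monomial n c =>
    rw [Polynomial.aeval_monomial]
    exact Commute.mul_left (Algebra.commutes c P)
      (Commute.pow_left (X_pow_finrank_comm P) n)

theorem natDegree_monic_aeval_X_pow {g : Polynomial F} (hg : g.Monic) :
    (Polynomial.aeval (X (frobq F K) ^ Module.finrank F K) g).natDegree =
      Module.finrank F K * g.natDegree ∧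
    (Polynomial.aeval (X (frobq F K) ^ Module.finrank F K) g).Monic := by
  have hr : 0 < Module.finrank F K := Module.finrank_pos
  have hle : (Polynomial.aeval (X (frobq F K) ^ Module.finrank F K) g).natDegree ≤
      Module.finrank F K * g.natDegree := by
    rw [natDegree_le_iff]
    intro k hk
    rw [aeval_X_pow_eq_sum, coeff_sum]
    refine Finset.sum_eq_zero fun i hi => ?_
    rw [coeff_monomial, if_neg]
    have := Nat.mul_le_mul_left (Module.finrank F K) (Finset.mem_range_succ_iff.1 hi)
    omega
  have htop : (Polynomial.aeval (X (frobq F K) ^ Module.finrank F K) g).coeff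
      (Module.finrank F K * g.natDegree) = 1 := by
    rw [aeval_X_pow_eq_sum, coeff_sum, Finset.sum_eq_single_of_mem g.natDegree (by simp)]
    · simp [coeff_monomial, hg.coeff_natDegree]
    · intro i _ hi
      rw [coeff_monomial, if_neg]
      exact fun h => hi (Nat.eq_of_mul_eq_mul_left hr h)
  have hdeg := le_antisymm hle (le_natDegree_of_ne_zero (by rw [htop]; exact one_ne_zero))
  exact ⟨hdeg, by rw [Monic, hdeg, htop]⟩

section

variable (M : Type*) [AddCommGroup M] [Module (SkewPoly (frobq F K)) M] [Module K M]
  [IsScalarTower K (SkewPoly (frobq F K)) M]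

/-- The `K`-linear endomorphism of a module given by `X ^ r`, where `r = [K : F]`. -/
def powEnd : Module.End K M where
  toFun m := X (frobq F K) ^ Module.finrank F K • m
  map_add' := smul_add _
  map_smul' a m := by rw [X_pow_smul_smul, frobq_iterate_finrank, RingHom.id_apply]

variable {M}

theorem powEnd_apply (m : M) :
    powEnd (F := F) (K := K) M m = X (frobq F K) ^ Module.finrank F K • m := rfl

variable [Module F M] [IsScalarTower F (SkewPoly (frobq F K)) M] [IsScalarTower F K M]

theorem aeval_powEnd_apply (g : Polynomial F) (m : M) :
    Polynomial.aeval (powEnd (F := F) (K := K) M) g m =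
      Polynomial.aeval (X (frobq F K) ^ Module.finrank F K) g • m := by
  have hpow : ∀ n : ℕ, (powEnd (F := F) (K := K) M ^ n) m =
      (X (frobq F K) ^ Module.finrank F K) ^ n • m := by
    intro n
    induction n with
    | zero => simp
    | succ n ih => rw [pow_succ', pow_succ', Module.End.mul_apply, ih, powEnd_apply, mul_smul]
  rw [Polynomial.aeval_eq_sum_range, Polynomial.aeval_eq_sum_range, Finset.sum_smul,
    LinearMap.sum_apply]
  refine Finset.sum_congr rfl fun i _ => ?_
  rw [LinearMap.smul_apply, hpow, smul_assoc]

end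

section

variable (M : Type*) [AddCommGroup M] [Module (SkewPoly (frobq F K)) M]

/-- The endomorphism of a module given by the central element `X ^ r`, where `r = [K : F]`. -/
def centralEnd : Module.End (SkewPoly (frobq F K)) M where
  toFun m := X (frobq F K) ^ Module.finrank F K • m
  map_add' := smul_add _
  map_smul' P m := by rw [smul_smul, X_pow_finrank_comm, mul_smul, RingHom.id_apply]

variable {M}

theorem centralEnd_apply (m : M) :
    centralEnd (F := F) (K := K) M m = X (frobq F K) ^ Module.finrank F K • m := rfl

variable [Module F M] [IsScalarTower F (SkewPoly (frobq F K)) M]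

theorem aeval_centralEnd_apply [SMulCommClass (SkewPoly (frobq F K)) F M] (g : Polynomial F)
    (m : M) :
    Polynomial.aeval (centralEnd (F := F) (K := K) M) g m =
      Polynomial.aeval (X (frobq F K) ^ Module.finrank F K) g • m := by
  have hpow : ∀ n : ℕ, (centralEnd (F := F) (K := K) M ^ n) m =
      (X (frobq F K) ^ Module.finrank F K) ^ n • m := by
    intro n
    induction n with
    | zero => simp
    | succ n ih => rw [pow_succ', pow_succ', Module.End.mul_apply, ih, centralEnd_apply, mul_smul]
  rw [Polynomial.aeval_eq_sum_range, Polynomial.aeval_eq_sum_range, Finset.sum_smul,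
    LinearMap.sum_apply]
  refine Finset.sum_congr rfl fun i _ => ?_
  rw [LinearMap.smul_apply, hpow, smul_assoc]

end

theorem map_Psi_eq_charpoly_powEnd {P : SkewPoly (frobq F K)} (hP : P.Monic) :
    haveI := finite_quo hP
    P.Psi.map (algebraMap F K) = (powEnd (F := F) (K := K) (Quo P)).charpoly := by
  have := finite_quo hP
  rw [map_Psi, ← LinearEquiv.charpoly_conj (quoEquiv hP)]
  congr 1
  refine LinearMap.ext fun q => ?_
  obtain ⟨v, rfl⟩ := (quoEquiv hP).surjective q
  rw [LinearEquiv.conj_apply_apply, LinearEquiv.symm_apply_apply, powEnd_apply]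
  have h : ∀ n : ℕ, toQuo P (P.phi^[n] v) = X (frobq F K) ^ n • toQuo P v := by
    intro n
    induction n with
    | zero => simp
    | succ n ih => rw [Function.iterate_succ_apply', toQuo_phi hP, ih, pow_succ', mul_smul]
  exact h (Module.finrank F K)

theorem Psi_monic (P : SkewPoly (frobq F K)) : P.Psi.Monic := by
  refine Polynomial.monic_of_injective (algebraMap F K).injective ?_
  rw [map_Psi]
  exact LinearMap.charpoly_monic _

theorem natDegree_Psi (P : SkewPoly (frobq F K)) : P.Psi.natDegree = P.natDegree := by
  rw [← Polynomial.natDegree_map (algebraMap F K), map_Psi, LinearMap.charpoly_natDegree,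
    Module.finrank_fin_fun]

end FiniteFields

end SkewPoly

/-! ### Characteristic polynomials in exact sequences. -/

section CharpolyExact

variable {K V V' V'' : Type*} [Field K] [AddCommGroup V] [Module K V] [Module.Finite K V]
  [AddCommGroup V'] [Module K V'] [Module.Finite K V']
  [AddCommGroup V''] [Module K V''] [Module.Finite K V'']

/-- The characteristic polynomial of an endomorphism preserving a subspace. -/
theorem LinearMap.charpoly_eq_charpoly_mul_charpoly (W : Submodule K V) (e : V →ₗ[K] V)
    (he : W ≤ W.comap e) :
    e.charpoly = (e.restrict he).charpoly * (W.mapQ W e he).charpoly := by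
  let bW := Module.Free.chooseBasis K W
  let bQ := Module.Free.chooseBasis K (V ⧸ W)
  let b := Module.Basis.sumQuot bW bQ
  let B := (LinearMap.toMatrix b b e).toBlocks₁₂
  -- In a basis of `W` completed by lifts of a basis of the quotient, the matrix is block upper
  -- triangular.
  have key : LinearMap.toMatrix b b e = Matrix.fromBlocks (LinearMap.toMatrix bW bW (e.restrict he))
      B 0 (LinearMap.toMatrix bQ bQ (W.mapQ W e he)) := by
    ext u v
    cases u with
    | inl i =>
      cases v with
      | inl k =>
        simp only [b, Module.Basis.sumQuot_inl, Matrix.fromBlocks_apply₁₁, LinearMap.toMatrix_apply]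
        apply Module.Basis.sumQuot_repr_inl_of_mem
      | inr l => rfl
    | inr j =>
      cases v with
      | inl k =>
        suffices W.mkQ (e (bW k)) = 0 by
          simp [b, LinearMap.toMatrix_apply, Module.Basis.sumQuot_repr_inr, this]
        rw [← LinearMap.mem_ker, Submodule.ker_mkQ]
        exact he (bW k).prop
      | inr l =>
        simp only [LinearMap.toMatrix_apply, Module.Basis.sumQuot_repr_inr,
          Matrix.fromBlocks_apply₂₂, b]
        rw [← Module.Basis.sumQuot_inr bW bQ l, W.mapQ_apply]
        simp
  rw [← LinearMap.charpoly_toMatrix e b, key, Matrix.charpoly_fromBlocks_zero₂₁,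
    LinearMap.charpoly_toMatrix, LinearMap.charpoly_toMatrix]

theorem LinearMap.charpoly_eq_mul_of_exact {f : V' →ₗ[K] V} {g : V →ₗ[K] V''}
    (hf : Function.Injective f) (hg : Function.Surjective g) (hfg : Function.Exact f g)
    {e' : Module.End K V'} {e : Module.End K V} {e'' : Module.End K V''}
    (h₁ : ∀ v, f (e' v) = e (f v)) (h₂ : ∀ v, g (e v) = e'' (g v)) :
    e.charpoly = e'.charpoly * e''.charpoly := by
  have he : LinearMap.ker g ≤ (LinearMap.ker g).comap e := fun v hv => by
    rw [Submodule.mem_comap, LinearMap.mem_ker, h₂, LinearMap.mem_ker.1 hv, map_zero]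
  rw [LinearMap.charpoly_eq_charpoly_mul_charpoly _ e he]
  have hker : LinearMap.range f = LinearMap.ker g := hfg.linearMap_ker_eq.symm
  let i₁ : V' ≃ₗ[K] LinearMap.ker g :=
    (LinearEquiv.ofInjective f hf).trans (LinearEquiv.ofEq _ _ hker)
  let i₂ : (V ⧸ LinearMap.ker g) ≃ₗ[K] V'' := g.quotKerEquivOfSurjective hg
  congr 1
  · rw [← LinearEquiv.charpoly_conj i₁ e']
    congr 1
    refine LinearMap.ext fun w => ?_
    obtain ⟨v, rfl⟩ := i₁.surjective w
    rw [LinearEquiv.conj_apply_apply, LinearEquiv.symm_apply_apply]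
    exact Subtype.ext (h₁ v).symm
  · rw [← LinearEquiv.charpoly_conj i₂]
    congr 1
    refine LinearMap.ext fun w => ?_
    obtain ⟨q, rfl⟩ := i₂.surjective w
    obtain ⟨v, rfl⟩ := Submodule.Quotient.mk_surjective _ q
    rw [LinearEquiv.conj_apply_apply, LinearEquiv.symm_apply_apply]
    exact h₂ v

end CharpolyExact

namespace SkewPoly

/-! ### Irreducibility and similarity in terms of modules. -/

section Basic

variable {K : Type*} [Field K] {σ : K →+* K}

theorem span_le_span_iff {P Q : SkewPoly σ} :
    Submodule.span (SkewPoly σ) {P} ≤ Submodule.span (SkewPoly σ) {Q} ↔ ∃ U, P = U * Q := by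
  rw [Submodule.span_singleton_le_iff_mem, mem_span_singleton_iff]

theorem span_eq_top_iff {P : SkewPoly σ} :
    Submodule.span (SkewPoly σ) {P} = ⊤ ↔ IsUnit P := by
  rw [Submodule.eq_top_iff']
  constructor
  · intro h
    obtain ⟨U, hU⟩ := mem_span_singleton_iff.1 (h 1)
    exact IsUnit.of_mul_eq_one_right U hU.symm
  · intro h f
    obtain ⟨U, hU⟩ := h.exists_left_inv
    exact mem_span_singleton_iff.2 ⟨f * U, by rw [mul_assoc, hU, mul_one]⟩

/-- Left ideals are principal, so those containing P are generated by right divisors of P;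
irreducibility says that P generates a maximal one. -/
theorem isSimpleModule_quo_iff {P : SkewPoly σ} (hP : P ≠ 0) :
    IsSimpleModule (SkewPoly σ) (Quo P) ↔ Irreducible P := by
  rw [isSimpleModule_iff_isCoatom]
  constructor
  · intro h
    refine ⟨fun hu => h.1 (span_eq_top_iff.2 hu), fun A B hAB => ?_⟩
    have hle : Submodule.span (SkewPoly σ) {P} ≤ Submodule.span (SkewPoly σ) {B} :=
      span_le_span_iff.2 ⟨A, hAB⟩
    rcases hle.eq_or_lt with heq | hlt
    · left
      obtain ⟨D, hD⟩ := span_le_span_iff.1 heq.ge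
      have hB : B ≠ 0 := by rintro rfl; exact hP (by rw [hAB, mul_zero])
      have h1 : D * A = 1 := by
        refine mul_right_cancel₀ hB ?_
        rw [mul_assoc, ← hAB, ← hD, one_mul]
      exact IsUnit.of_mul_eq_one_right D h1
    · right
      exact span_eq_top_iff.1 (h.2 _ hlt)
  · intro h
    refine ⟨fun ht => h.not_isUnit (span_eq_top_iff.1 ht), fun I hI => ?_⟩
    obtain ⟨B, -, rfl⟩ := exists_monic_span (I := I) (ne_bot_of_gt hI)
    obtain ⟨A, hA⟩ := span_le_span_iff.1 hI.le
    rcases h.isUnit_or_isUnit hA with hu | hu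
    · exfalso
      obtain ⟨D, hD⟩ := hu.exists_left_inv
      refine hI.not_ge (span_le_span_iff.2 ⟨D, ?_⟩)
      rw [hA, ← mul_assoc, hD, one_mul]
    · exact span_eq_top_iff.2 hu

/-- Right multiplication by `U` as a map of quotient modules. -/
def quoMul {P Q : SkewPoly σ} (U : SkewPoly σ) (h : RightDvd P (Q * U)) :
    Quo Q →ₗ[SkewPoly σ] Quo P :=
  Submodule.mapQ _ _ (LinearMap.toSpanSingleton (SkewPoly σ) (SkewPoly σ) U) <| by
    rw [Submodule.span_singleton_le_iff_mem, Submodule.mem_comap]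
    exact mem_span_singleton_iff.2 h

theorem quoMul_mk {P Q : SkewPoly σ} (U : SkewPoly σ) (h : RightDvd P (Q * U)) (f : SkewPoly σ) :
    quoMul U h (Submodule.Quotient.mk f) = Submodule.Quotient.mk (f * U) := rfl

theorem quo_mk_eq_zero_iff {P f : SkewPoly σ} :
    (Submodule.Quotient.mk f : Quo P) = 0 ↔ ∃ g, f = g * P := by
  rw [Submodule.Quotient.mk_eq_zero, mem_span_singleton_iff]

/-- Two polynomials have right greatest common divisor `1` if and only if they generate the unit
left ideal. -/
theorem isRGCD_one_iff {U P : SkewPoly σ} (hP : P ≠ 0) :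
    IsRGCD 1 U P ↔ ∃ A B : SkewPoly σ, A * U + B * P = 1 := by
  constructor
  · intro h
    have hne : Submodule.span (SkewPoly σ) {U, P} ≠ ⊥ := by
      intro hb
      exact hP ((Submodule.span_eq_bot.1 hb) P (by simp))
    obtain ⟨D, -, hD⟩ := exists_monic_span hne
    have hU : U ∈ Submodule.span (SkewPoly σ) {U, P} := Submodule.subset_span (by simp)
    have hP : P ∈ Submodule.span (SkewPoly σ) {U, P} := Submodule.subset_span (by simp)
    obtain ⟨V, hV⟩ := h.greatest D (mem_span_singleton_iff.1 (hD ▸ hU))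
      (mem_span_singleton_iff.1 (hD ▸ hP))
    have h1 : (1 : SkewPoly σ) ∈ Submodule.span (SkewPoly σ) {U, P} := by
      rw [hD]; exact mem_span_singleton_iff.2 ⟨V, hV⟩
    exact Submodule.mem_span_pair.1 h1
  · rintro ⟨A, B, hAB⟩
    refine ⟨⟨U, (mul_one U).symm⟩, ⟨P, (mul_one P).symm⟩, ?_⟩
    rintro E ⟨V, rfl⟩ ⟨W, rfl⟩
    exact ⟨A * V + B * W, by rw [add_mul, mul_assoc, mul_assoc, hAB]⟩

/-- Similarity of polynomials is isomorphism of the associated modules. -/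
theorem similar_iff_nonempty_quo_equiv {P Q : SkewPoly σ} (hP : P ≠ 0) (hPu : ¬ IsUnit P) :
    P.Similar Q ↔ Nonempty (Quo Q ≃ₗ[SkewPoly σ] Quo P) := by
  constructor
  · rintro ⟨U, hgcd, hlcm⟩
    obtain ⟨A, B, hAB⟩ := (isRGCD_one_iff hP).1 hgcd
    -- Non-invertibility of P is needed here: for a unit P, the choice U = 0 would make every Q
    -- similar to P.
    have hU : U ≠ 0 := by
      rintro rfl
      rw [mul_zero, zero_add] at hAB
      exact hPu (IsUnit.of_mul_eq_one_right B hAB)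
    refine ⟨LinearEquiv.ofBijective (quoMul U hlcm.right) ⟨?_, ?_⟩⟩
    -- Injectivity is minimality of the left lcm; surjectivity is the Bézout identity.
    · rw [injective_iff_map_eq_zero]
      intro q hq
      obtain ⟨f, rfl⟩ := Submodule.Quotient.mk_surjective _ q
      rw [quoMul_mk, quo_mk_eq_zero_iff] at hq
      obtain ⟨g, hg⟩ := hlcm.lowest (f * U) ⟨f, rfl⟩ hq
      rw [quo_mk_eq_zero_iff]
      exact ⟨g, mul_right_cancel₀ hU (by rw [hg, mul_assoc])⟩
    · intro q
      obtain ⟨f, rfl⟩ := Submodule.Quotient.mk_surjective _ q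
      refine ⟨Submodule.Quotient.mk (f * A), ?_⟩
      rw [quoMul_mk, Submodule.Quotient.eq, mem_span_singleton_iff]
      refine ⟨-(f * B), ?_⟩
      rw [mul_assoc, eq_sub_of_add_eq hAB, mul_sub, mul_one, neg_mul, mul_assoc]
      abel
  · rintro ⟨e⟩
    -- An isomorphism is right multiplication by any representative U of the image of 1.
    obtain ⟨U, hU⟩ := Submodule.Quotient.mk_surjective _ (e (Submodule.Quotient.mk 1))
    have he : ∀ f, e (Submodule.Quotient.mk f) = Submodule.Quotient.mk (f * U) := fun f => by
      rw [← smul_eq_mul f U, Submodule.Quotient.mk_smul, hU, ← map_smul,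
        ← Submodule.Quotient.mk_smul, smul_eq_mul, mul_one]
    refine ⟨U, (isRGCD_one_iff hP).2 ?_, ⟨Q, rfl⟩, ?_, ?_⟩
    · obtain ⟨q, hq⟩ := e.surjective (Submodule.Quotient.mk 1)
      obtain ⟨A, rfl⟩ := Submodule.Quotient.mk_surjective _ q
      rw [he, eq_comm, Submodule.Quotient.eq, mem_span_singleton_iff] at hq
      obtain ⟨B, hB⟩ := hq
      exact ⟨A, B, by rw [← hB]; abel⟩
    · have := he Q
      rw [mk_self, map_zero, eq_comm, quo_mk_eq_zero_iff] at this
      exact this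
    · rintro N ⟨f, rfl⟩ hN
      have h0 : e (Submodule.Quotient.mk f) = 0 := by rwa [he, quo_mk_eq_zero_iff]
      rw [map_eq_zero_iff e e.injective, quo_mk_eq_zero_iff] at h0
      obtain ⟨g, rfl⟩ := h0
      exact ⟨g, mul_assoc _ _ _⟩

end Basic

/-! ### Invariance and multiplicativity of Ψ. -/

section FiniteFields

variable {F K : Type*} [Field F] [Fintype F] [Field K] [Algebra F K] [Finite K]

theorem Psi_eq_of_equiv {P Q : SkewPoly (frobq F K)} (hP : P.Monic) (hQ : Q.Monic)
    (e : Quo Q ≃ₗ[SkewPoly (frobq F K)] Quo P) : P.Psi = Q.Psi := by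
  have := finite_quo hP
  have := finite_quo hQ
  refine Polynomial.map_injective _ (algebraMap F K).injective ?_
  rw [map_Psi_eq_charpoly_powEnd hP, map_Psi_eq_charpoly_powEnd hQ,
    ← LinearEquiv.charpoly_conj (e.restrictScalars K) (powEnd (Quo Q))]
  congr 1
  refine LinearMap.ext fun q => ?_
  obtain ⟨v, rfl⟩ := (e.restrictScalars K).surjective q
  rw [LinearEquiv.conj_apply_apply, LinearEquiv.symm_apply_apply]
  exact (e.map_smul _ v).symm

/-- Right multiplication by B and reduction modulo B give an exact sequence 0 → `Quo A` → `Quo (A *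
B)` → `Quo B` → 0 compatible with X^r. -/
theorem Psi_mul {A B : SkewPoly (frobq F K)} (hA : A.Monic) (hB : B.Monic) :
    (A * B).Psi = A.Psi * B.Psi := by
  have := finite_quo hA
  have := finite_quo hB
  have hAB := hA.mul hB
  have := finite_quo hAB
  refine Polynomial.map_injective _ (algebraMap F K).injective ?_
  rw [Polynomial.map_mul, map_Psi_eq_charpoly_powEnd hA, map_Psi_eq_charpoly_powEnd hB,
    map_Psi_eq_charpoly_powEnd hAB]
  let f : Quo A →ₗ[SkewPoly (frobq F K)] Quo (A * B) := quoMul B ⟨1, (one_mul _).symm⟩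
  let g : Quo (A * B) →ₗ[SkewPoly (frobq F K)] Quo B := quoMul 1 ⟨A, mul_one _⟩
  have hf : ∀ s, f (Submodule.Quotient.mk s) = Submodule.Quotient.mk (s * B) := fun _ => rfl
  have hg : ∀ s, g (Submodule.Quotient.mk s) = Submodule.Quotient.mk s := fun s =>
    (quoMul_mk _ _ _).trans (by rw [mul_one])
  refine LinearMap.charpoly_eq_mul_of_exact (f := f.restrictScalars K) (g := g.restrictScalars K)
    ?_ ?_ ?_ (fun v => f.map_smul _ v) (fun v => g.map_smul _ v)
  · change Function.Injective f
    rw [injective_iff_map_eq_zero]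
    intro q hq
    obtain ⟨s, rfl⟩ := Submodule.Quotient.mk_surjective _ q
    rw [hf, quo_mk_eq_zero_iff] at hq
    obtain ⟨t, ht⟩ := hq
    rw [quo_mk_eq_zero_iff]
    exact ⟨t, mul_right_cancel₀ hB.ne_zero (by rw [ht, mul_assoc])⟩
  · intro q
    obtain ⟨s, rfl⟩ := Submodule.Quotient.mk_surjective _ q
    exact ⟨Submodule.Quotient.mk s, hg s⟩
  · intro q
    obtain ⟨s, rfl⟩ := Submodule.Quotient.mk_surjective _ q
    change g _ = 0 ↔ _
    rw [hg, quo_mk_eq_zero_iff]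
    constructor
    · rintro ⟨t, rfl⟩
      exact ⟨Submodule.Quotient.mk t, rfl⟩
    · rintro ⟨p, hp⟩
      obtain ⟨t, rfl⟩ := Submodule.Quotient.mk_surjective _ p
      change f _ = _ at hp
      rw [hf, Submodule.Quotient.eq, mem_span_singleton_iff] at hp
      obtain ⟨u, hu⟩ := hp
      refine ⟨t - u * A, ?_⟩
      rw [sub_mul, mul_assoc, ← hu]
      abel

end FiniteFields

/-! ### Independence of Frobenius powers and descent along the trace. -/

section FiniteFields

variable {F K : Type*} [Field F] [Fintype F] [Field K] [Algebra F K]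

theorem frobq_iterate_eq_coe_pow (n : ℕ) (a : K) :
    (frobq F K)^[n] a = (FiniteField.frobeniusAlgHom F K ^ n) a := by
  rw [AlgHom.coe_pow]
  rfl

variable [Finite K]

theorem frobq_iterate_mod (n : ℕ) (a : K) :
    (frobq F K)^[n % Module.finrank F K] a = (frobq F K)^[n] a := by
  rw [frobq_iterate_eq_coe_pow, frobq_iterate_eq_coe_pow, ← FiniteField.orderOf_frobeniusAlgHom F K,
    pow_mod_orderOf]

/-- Independence of the powers of the Frobenius, with coefficients in a vector space. -/
theorem eq_zero_of_sum_frobq_iterate_smul {M : Type*} [AddCommGroup M] [Module K M] (v : ℕ → M)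
    (h : ∀ a : K, ∑ i ∈ Finset.range (Module.finrank F K), (frobq F K)^[i] a • v i = 0)
    {i : ℕ} (hi : i < Module.finrank F K) : v i = 0 := by
  -- Linear functionals reduce to scalar coefficients, where Dedekind independence applies:
  -- Frobenius has order r, so its first r powers are distinct.
  rw [← Module.forall_dual_apply_eq_zero_iff K]
  intro ℓ
  have hinj : Function.Injective fun i : Fin (Module.finrank F K) =>
      (((FiniteField.frobeniusAlgHom F K ^ (i : ℕ) : K →ₐ[F] K) : K →+* K) : K →* K) := by
    intro i j hij
    have hij' : FiniteField.frobeniusAlgHom F K ^ (i : ℕ) =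
        FiniteField.frobeniusAlgHom F K ^ (j : ℕ) :=
      AlgHom.ext fun a => DFunLike.congr_fun hij a
    refine Fin.ext (pow_injOn_Iio_orderOf ?_ ?_ hij')
    · rw [FiniteField.orderOf_frobeniusAlgHom]; exact i.2
    · rw [FiniteField.orderOf_frobeniusAlgHom]; exact j.2
  have hli := (linearIndependent_monoidHom K K).comp _ hinj
  refine Fintype.linearIndependent_iff.1 hli (fun i => ℓ (v i)) ?_ ⟨i, hi⟩
  ext a
  have := congrArg ℓ (h a)
  rw [map_sum, map_zero, Finset.sum_range] at this
  rw [Finset.sum_apply, Pi.zero_apply, ← this]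
  refine Finset.sum_congr rfl fun j _ => ?_
  rw [map_smul, frobq_iterate_eq_coe_pow, Pi.smul_apply, smul_eq_mul, smul_eq_mul, mul_comm]
  rfl

section

variable {M : Type*} [AddCommGroup M] [Module (SkewPoly (frobq F K)) M] [Module K M]
  [IsScalarTower K (SkewPoly (frobq F K)) M]

theorem powEnd_pow_apply (n : ℕ) (m : M) :
    (powEnd (F := F) (K := K) M ^ n) m = X (frobq F K) ^ (Module.finrank F K * n) • m := by
  induction n with
  | zero => simp
  | succ n ih =>
    rw [pow_succ', Module.End.mul_apply, ih, powEnd_apply, smul_smul, ← pow_add, mul_add, mul_one,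
      add_comm]

theorem aeval_monomial_powEnd_apply (n : ℕ) (a : K) (m : M) :
    Polynomial.aeval (powEnd (F := F) (K := K) M) (Polynomial.monomial n a) m =
      a • X (frobq F K) ^ (Module.finrank F K * n) • m := by
  rw [Polynomial.aeval_monomial, Module.End.mul_apply, powEnd_pow_apply,
    Module.algebraMap_end_apply]

theorem X_smul_aeval_powEnd (G : Polynomial K) (m : M) :
    X (frobq F K) • Polynomial.aeval (powEnd (F := F) (K := K) M) G m =
      Polynomial.aeval (powEnd (F := F) (K := K) M) (G.map (frobq F K)) (X (frobq F K) • m) := by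
  induction G using Polynomial.induction_on' with
  | add G H hG hH =>
    rw [map_add, Polynomial.map_add, map_add, LinearMap.add_apply, LinearMap.add_apply, smul_add,
      hG, hH]
  | monomial n a =>
    rw [Polynomial.map_monomial, aeval_monomial_powEnd_apply, aeval_monomial_powEnd_apply,
      X_smul_smul, smul_smul (X _), smul_smul _ (X _), ← pow_succ, ← pow_succ']

/-- A skew polynomial whose action is `K`-linear acts as a polynomial in `X ^ r`. -/
theorem exists_smul_eq_aeval_powEnd (s : SkewPoly (frobq F K))
    (hs : ∀ (a : K) (m : M), s • a • m = a • s • m) :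
    ∃ G : Polynomial K, ∀ m : M, s • m = Polynomial.aeval (powEnd (F := F) (K := K) M) G m := by
  set r := Module.finrank F K with hr
  have hr0 : 0 < r := Module.finrank_pos
  set N := s.natDegree + 1
  have hsm : ∀ m : M, s • m = ∑ j ∈ Finset.range N, s.coeff j • X (frobq F K) ^ j • m := by
    intro m
    conv_lhs => rw [eq_sum_monomial (Nat.lt_succ_self s.natDegree), Finset.sum_smul]
    exact Finset.sum_congr rfl fun j _ => monomial_smul _ _ _
  -- G keeps exactly the terms of s whose exponent is divisible by r.
  refine ⟨∑ j ∈ Finset.range N with j % r = 0, Polynomial.monomial (j / r) (s.coeff j), fun m => ?_⟩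
  have hG : Polynomial.aeval (powEnd (F := F) (K := K) M)
      (∑ j ∈ Finset.range N with j % r = 0, Polynomial.monomial (j / r) (s.coeff j)) m =
      ∑ j ∈ Finset.range N with j % r = 0, s.coeff j • X (frobq F K) ^ j • m := by
    rw [map_sum, LinearMap.sum_apply]
    refine Finset.sum_congr rfl fun j hj => ?_
    rw [aeval_monomial_powEnd_apply, ← hr, Nat.mul_div_cancel' (Nat.dvd_of_mod_eq_zero
      (Finset.mem_filter.1 hj).2)]
  rw [hG]
  -- With exponents grouped by residue i mod r, s • a • m is a sum of σ^i(a) times vectors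
  -- independent of a. Comparing it with a • s • m isolates the component i = 0.
  have key := eq_zero_of_sum_frobq_iterate_smul (F := F) (K := K)
    (fun i => ∑ j ∈ Finset.range N with j % r = i, s.coeff j • X (frobq F K) ^ j • m -
      if i = 0 then s • m else 0) (fun a => ?_) hr0
  · rw [if_pos rfl, sub_eq_zero] at key
    exact key.symm
  · have h1 : s • a • m = ∑ i ∈ Finset.range r,
        (frobq F K)^[i] a • ∑ j ∈ Finset.range N with j % r = i,
          s.coeff j • X (frobq F K) ^ j • m := by
      rw [hsm, ← Finset.sum_fiberwise_of_maps_to (t := Finset.range r) (g := fun j => j % r)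
        fun j _ => Finset.mem_range.2 (Nat.mod_lt j hr0)]
      refine Finset.sum_congr rfl fun i _ => ?_
      rw [Finset.smul_sum]
      refine Finset.sum_congr rfl fun j hj => ?_
      rw [X_pow_smul_smul, smul_comm, ← (Finset.mem_filter.1 hj).2, hr, frobq_iterate_mod]
    simp only [smul_sub, Finset.sum_sub_distrib]
    rw [← h1, hs, Finset.sum_eq_single_of_mem 0 (Finset.mem_range.2 hr0)]
    · simp
    · intro i _ hi
      rw [if_neg hi, smul_zero]

theorem X_pow_smul_aeval_powEnd (k : ℕ) (G : Polynomial K) (m : M) :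
    X (frobq F K) ^ k • Polynomial.aeval (powEnd (F := F) (K := K) M) G m =
      Polynomial.aeval (powEnd (F := F) (K := K) M) (G.map (frobq F K ^ k))
        (X (frobq F K) ^ k • m) := by
  induction k generalizing G m with
  | zero =>
    rw [pow_zero, pow_zero, one_smul, one_smul, show (1 : K →+* K) = RingHom.id K from rfl,
      Polynomial.map_id]
  | succ k ih =>
    rw [pow_succ, mul_smul, X_smul_aeval_powEnd, ih, Polynomial.map_map, mul_smul]
    rfl

theorem sum_frobq_pow_eq_trace (a : K) :
    ∑ k ∈ Finset.range (Module.finrank F K), (frobq F K ^ k) a =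
      algebraMap F K (Algebra.trace F K a) := by
  rw [FiniteField.algebraMap_trace_eq_sum_pow]
  refine Finset.sum_congr rfl fun k hk => ?_
  clear hk
  rw [Nat.card_eq_fintype_card, RingHom.coe_pow]
  induction k with
  | zero => simp
  | succ k ih => rw [Function.iterate_succ_apply', ih, frobq_apply, ← pow_mul, pow_succ]

/-- Descent along the trace: an action of a polynomial in `X ^ r` with coefficients in `K` which
commutes with `X` is the action of a polynomial in `X ^ r` with coefficients in `F`. -/
theorem exists_aeval_powEnd_eq_of_commute (hX : Function.Surjective fun m : M => X (frobq F K) • m)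
    (G : Polynomial K)
    (hG : ∀ m : M, X (frobq F K) • Polynomial.aeval (powEnd (F := F) (K := K) M) G m =
      Polynomial.aeval (powEnd (F := F) (K := K) M) G (X (frobq F K) • m)) :
    ∃ g : Polynomial F, Polynomial.aeval (powEnd (F := F) (K := K) M) G =
      Polynomial.aeval (powEnd (F := F) (K := K) M) (g.map (algebraMap F K)) := by
  obtain ⟨c, hc⟩ := Algebra.trace_surjective F K 1
  have hXk : ∀ k : ℕ, Function.Surjective fun m : M => X (frobq F K) ^ k • m := by
    intro k
    induction k with
    | zero => intro m; exact ⟨m, by simp⟩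
    | succ k ih =>
      intro m
      obtain ⟨m', rfl⟩ := ih m
      obtain ⟨m'', rfl⟩ := hX m'
      exact ⟨m'', by simp [pow_succ, mul_smul]⟩
  have hGk : ∀ (k : ℕ) (m : M),
      X (frobq F K) ^ k • Polynomial.aeval (powEnd (F := F) (K := K) M) G m =
        Polynomial.aeval (powEnd (F := F) (K := K) M) G (X (frobq F K) ^ k • m) := by
    intro k
    induction k with
    | zero => simp
    | succ k ih => intro m; rw [pow_succ', mul_smul, ih, hG, mul_smul]
  -- Moving X^k past G(X^r) twists the coefficients by σ^k; as X^k is surjective, the twist does not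
  -- change the operator.
  have htw : ∀ k : ℕ, Polynomial.aeval (powEnd (F := F) (K := K) M) (G.map (frobq F K ^ k)) =
      Polynomial.aeval (powEnd (F := F) (K := K) M) G := by
    intro k
    refine LinearMap.ext fun m => ?_
    obtain ⟨m, rfl⟩ := hXk k m
    exact (X_pow_smul_aeval_powEnd k G m).symm.trans (hGk k m)
  -- The coefficients are the traces of c·G_i, with c of trace 1. Over K this polynomial is the sum
  -- of the twists of cG, which acts as Tr(c)·G(X^r) = G(X^r).
  refine ⟨∑ i ∈ Finset.range (G.natDegree + 1),
    Polynomial.monomial i (Algebra.trace F K (c * G.coeff i)), ?_⟩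
  have hmap : (∑ i ∈ Finset.range (G.natDegree + 1),
      Polynomial.monomial i (Algebra.trace F K (c * G.coeff i))).map (algebraMap F K) =
      ∑ k ∈ Finset.range (Module.finrank F K), (Polynomial.C c * G).map (frobq F K ^ k) := by
    ext n
    simp only [Polynomial.coeff_map, Polynomial.finsetSum_coeff, Polynomial.coeff_monomial,
      Finset.sum_ite_eq', Polynomial.coeff_C_mul, Finset.mem_range]
    rw [sum_frobq_pow_eq_trace]
    split_ifs with h
    · rfl
    · rw [Polynomial.coeff_eq_zero_of_natDegree_lt (by omega), mul_zero,
        map_zero (Algebra.trace F K), map_zero]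
  rw [hmap, map_sum]
  simp only [Polynomial.map_mul, Polynomial.map_C, map_mul, htw]
  rw [← Finset.sum_mul, ← map_sum, ← map_sum, sum_frobq_pow_eq_trace, hc, map_one, map_one, map_one,
    one_mul]

end

end FiniteFields

/-! ### The action of X on a simple module, and density. -/

section Module

variable {K : Type*} [Field K] {σ : K →+* K} {M : Type*} [AddCommGroup M] [Module (SkewPoly σ) M]

/-- This makes the kernel of X a submodule, although X need not be central. -/
theorem X_mul_eq_mul_X (s : SkewPoly σ) :
    ∃ t, X σ * s = t * X σ := by
  induction s using induction_monomial with
  | h0 => exact ⟨0, by simp⟩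
  | hadd P Q hP hQ =>
    obtain ⟨t, ht⟩ := hP
    obtain ⟨u, hu⟩ := hQ
    exact ⟨t + u, by rw [mul_add, add_mul, ht, hu]⟩
  | hmon n a =>
    refine ⟨monomial _ n (σ a), ?_⟩
    rw [X, monomial_mul_monomial, monomial_mul_monomial, add_comm]
    simp

/-- On a simple module the variable acts by zero or injectively. -/
theorem X_smul_eq_zero_or_injective [IsSimpleModule (SkewPoly σ) M] :
    (∀ m : M, X σ • m = 0) ∨ Function.Injective fun m : M => X σ • m := by
  let N : Submodule (SkewPoly σ) M :=
    { carrier := {m | X σ • m = 0}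
      add_mem' := fun {a b} ha hb => by
        change X σ • (a + b) = 0
        rw [smul_add, show X σ • a = 0 from ha, show X σ • b = 0 from hb,
          add_zero]
      zero_mem' := smul_zero _
      smul_mem' := fun s m hm => by
        obtain ⟨t, ht⟩ := X_mul_eq_mul_X s
        change X σ • s • m = 0
        rw [smul_smul, ht, mul_smul, show X σ • m = 0 from hm, smul_zero] }
  rcases eq_bot_or_eq_top N with h | h
  · right
    intro a b hab
    have : a - b ∈ N := by
      change X σ • (a - b) = 0
      rw [smul_sub, sub_eq_zero]
      exact hab
    rw [h, Submodule.mem_bot, sub_eq_zero] at this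
    exact this
  · left
    intro m
    have : m ∈ N := h ▸ Submodule.mem_top
    exact this

variable [Module K M] [IsScalarTower K (SkewPoly σ) M]

theorem smul_eq_coeff_zero_smul (h : ∀ m : M, X σ • m = 0) (s : SkewPoly σ)
    (m : M) : s • m = s.coeff 0 • m := by
  induction s using induction_monomial with
  | h0 => simp
  | hadd P Q hP hQ => rw [add_smul, hP, hQ, coeff_add, add_smul]
  | hmon n a =>
    rw [monomial_smul, coeff_monomial]
    rcases Nat.eq_zero_or_pos n with rfl | hn
    · simp
    · obtain ⟨k, rfl⟩ := Nat.exists_eq_succ_of_ne_zero hn.ne'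
      rw [pow_succ, mul_smul, h, smul_zero, smul_zero, if_neg (by omega), zero_smul]

/-- A simple module killed by the variable is a line. -/
theorem finrank_eq_one_of_X_smul_eq_zero [IsSimpleModule (SkewPoly σ) M]
    (h : ∀ m : M, X σ • m = 0) : Module.finrank K M = 1 := by
  have := IsSimpleModule.nontrivial (SkewPoly σ) M
  obtain ⟨m, hm⟩ := exists_ne (0 : M)
  refine finrank_eq_one m hm fun w => ?_
  obtain ⟨s, hs⟩ := IsSimpleModule.toSpanSingleton_surjective (SkewPoly σ) hm w
  exact ⟨s.coeff 0, by rw [← smul_eq_coeff_zero_smul h, ← hs]; rfl⟩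

end Module

/-- The density theorem for a simple module which is finite. -/
theorem exists_smul_eq_end_smul {R M : Type*} [Ring R] [AddCommGroup M] [Module R M] [Finite M]
    [IsSimpleModule R M]
    (f : Module.End (Module.End R M) M) :
    ∃ s : R, ∀ m : M, s • m = f m := by
  obtain ⟨s, hs⟩ := Module.Finite.toModuleEnd_moduleEnd_surjective (R := R) f
  exact ⟨s, fun m => by rw [← hs]; rfl⟩

/-! ### Endomorphisms of a simple module and the dimension count. -/

section FiniteFields

variable {F K : Type*} [Field F] [Fintype F] [Field K] [Algebra F K] [Finite K]

theorem isIntegral_centralEnd {M : Type*} [AddCommGroup M] [Module (SkewPoly (frobq F K)) M]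
    [Module F M] [IsScalarTower F (SkewPoly (frobq F K)) M] [Finite M] :
    IsIntegral F (centralEnd (F := F) (K := K) M) := by
  have : Finite (Module.End (SkewPoly (frobq F K)) M) := DFunLike.finite _
  exact IsIntegral.of_finite F _

section

variable {M : Type*} [AddCommGroup M] [Module (SkewPoly (frobq F K)) M] [Module K M]
  [IsScalarTower K (SkewPoly (frobq F K)) M]

variable [Module F M] [IsScalarTower F (SkewPoly (frobq F K)) M] [IsScalarTower F K M]

theorem aeval_centralEnd_eq_powEnd (g : Polynomial F) (m : M) :
    Polynomial.aeval (centralEnd (F := F) (K := K) M) g m =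
      Polynomial.aeval (powEnd (F := F) (K := K) M) (g.map (algebraMap F K)) m := by
  rw [Polynomial.aeval_map_algebraMap, aeval_powEnd_apply, aeval_centralEnd_apply]

variable [Module.Finite K M] [IsSimpleModule (SkewPoly (frobq F K)) M]

/-- If the variable does not kill the simple module `M`, the endomorphisms of `M` are the
polynomials in `X ^ r` with coefficients in `F`. -/
theorem exists_eq_aeval_centralEnd
    (hX : Function.Injective fun m : M => X (frobq F K) • m)
    (z : Module.End (SkewPoly (frobq F K)) M) :
    ∃ g : Polynomial F, z = Polynomial.aeval (centralEnd (F := F) (K := K) M) g := by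
  classical
  have : Finite M := Module.finite_of_finite K
  have : Finite (Module.End (SkewPoly (frobq F K)) M) := DFunLike.finite _
  -- The endomorphism ring is a division ring by Schur, hence commutative by Wedderburn. So z is
  -- linear over it, and density realises z as the action of some s.
  have hcomm : ∀ a b : Module.End (SkewPoly (frobq F K)) M, a * b = b * a :=
    (Finite.isDomain_to_isField (Module.End (SkewPoly (frobq F K)) M)).mul_comm
  let f : Module.End (Module.End (SkewPoly (frobq F K)) M) M :=
    { toFun := z
      map_add' := z.map_add
      map_smul' := fun a m => LinearMap.congr_fun (hcomm z a) m }
  obtain ⟨s, hs⟩ := exists_smul_eq_end_smul f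
  replace hs : ∀ m, s • m = z m := hs
  obtain ⟨G, hG⟩ := exists_smul_eq_aeval_powEnd (M := M) s fun a m => by
    rw [hs, hs, ← C_smul (σ := frobq F K), map_smul, C_smul]
  obtain ⟨g, hg⟩ := exists_aeval_powEnd_eq_of_commute (M := M) (Finite.surjective_of_injective hX) G
    fun m => by rw [← hG, ← hG, hs, hs, map_smul]
  refine ⟨g, LinearMap.ext fun m => ?_⟩
  rw [aeval_centralEnd_eq_powEnd, ← hg, ← hG, hs]

/-- Every endomorphism is a polynomial in X^r over F, and only its remainder modulo the minimal
polynomial matters. -/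
theorem natCard_end_le (hX : Function.Injective fun m : M => X (frobq F K) • m) :
    Nat.card (Module.End (SkewPoly (frobq F K)) M) ≤
      Nat.card F ^ (minpoly F (centralEnd (F := F) (K := K) M)).natDegree := by
  have : Finite M := Module.finite_of_finite K
  have hint : IsIntegral F (centralEnd (F := F) (K := K) M) := isIntegral_centralEnd
  set R := minpoly F (centralEnd (F := F) (K := K) M) with hR
  have hmon : R.Monic := minpoly.monic hint
  have hsurj : Function.Surjective fun v : Fin R.natDegree → F =>
      Polynomial.aeval (centralEnd (F := F) (K := K) M)
        ((Polynomial.degreeLTEquiv F R.natDegree).symm v : Polynomial F) := by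
    intro z
    obtain ⟨g, hg⟩ := exists_eq_aeval_centralEnd hX z
    have hlt : g %ₘ R ∈ Polynomial.degreeLT F R.natDegree := by
      rw [Polynomial.mem_degreeLT, ← Polynomial.degree_eq_natDegree hmon.ne_zero]
      exact Polynomial.degree_modByMonic_lt g hmon
    refine ⟨Polynomial.degreeLTEquiv F R.natDegree ⟨_, hlt⟩, ?_⟩
    simp only [LinearEquiv.symm_apply_apply]
    rw [hg, Polynomial.modByMonic_eq_sub_mul_div _ R, map_sub, map_mul, hR, minpoly.aeval,
      zero_mul, sub_zero]
  have := Nat.card_le_card_of_surjective _ hsurj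
  rwa [Nat.card_fun, Nat.card_fin] at this

/-- Two counts in powers of q bound μ = dim_E M from both sides, rn ≤ dμ and nμ ≤ rd. Eliminating μ
gives n ≤ d, and equality makes the action map from `Quo T` to End_E(M) bijective. -/
theorem finrank_le_and_annihilator (hX : Function.Injective fun m : M => X (frobq F K) • m) :
    Module.finrank K M ≤ (minpoly F (centralEnd (F := F) (K := K) M)).natDegree ∧
    (Module.finrank K M = (minpoly F (centralEnd (F := F) (K := K) M)).natDegree →
      ∀ s : SkewPoly (frobq F K), (∀ m : M, s • m = 0) →
        ∃ g, s = g * Polynomial.aeval (X (frobq F K) ^ Module.finrank F K)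
          (minpoly F (centralEnd (F := F) (K := K) M))) := by
  classical
  have hfinM : Finite M := Module.finite_of_finite K
  have : Finite (Module.End (SkewPoly (frobq F K)) M) := DFunLike.finite _
  have := IsSimpleModule.nontrivial (SkewPoly (frobq F K)) M
  have hint : IsIntegral F (centralEnd (F := F) (K := K) M) := isIntegral_centralEnd
  have hE := natCard_end_le (F := F) (K := K) hX
  have haev := minpoly.aeval F (centralEnd (F := F) (K := K) M)
  have hmon := minpoly.monic hint
  set R := minpoly F (centralEnd (F := F) (K := K) M) with hR
  obtain ⟨hTdeg, hTmon⟩ := natDegree_monic_aeval_X_pow (K := K) hmon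
  have hTm : ∀ m : M, Polynomial.aeval (X (frobq F K) ^ Module.finrank F K) R • m = 0 := fun m => by
    rw [← aeval_centralEnd_apply, haev, LinearMap.zero_apply]
  set T := Polynomial.aeval (X (frobq F K) ^ Module.finrank F K) R with hT
  set E := Module.End (SkewPoly (frobq F K)) M
  set r := Module.finrank F K with hr
  set d := R.natDegree with hd
  set n := Module.finrank K M with hn
  set μ := Module.finrank E M with hμ
  have hr0 : 0 < r := Module.finrank_pos
  have hn0 : 0 < n := Module.finrank_pos
  have hq : 1 < Nat.card F := Finite.one_lt_card
  have hcardK : Nat.card K = Nat.card F ^ r := Module.natCard_eq_pow_finrank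
  have hcardM : Nat.card M = Nat.card F ^ (r * n) := by
    rw [Module.natCard_eq_pow_finrank (K := K), hcardK, pow_mul]
  have hcardM' : Nat.card M = Nat.card E ^ μ := Module.natCard_eq_pow_finrank
  have h1 : r * n ≤ d * μ := by
    rw [← Nat.pow_le_pow_iff_right hq, ← hcardM, hcardM', pow_mul]
    exact Nat.pow_le_pow_left hE μ
  -- An E-linear map is determined by the free choice of images of the μ basis vectors in M.
  have hcardEnd : Nat.card (Module.End E M) = Nat.card F ^ (r * n * μ) := by
    have b := Module.finBasis E M
    rw [← Nat.card_congr (b.constr ℕ).toEquiv, Nat.card_fun, Nat.card_fin, hcardM, pow_mul _ _ μ]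
  have hfinT := finite_quo hTmon
  have : Finite (Quo T) := Module.finite_of_finite K
  have hcardT : Nat.card (Quo T) = Nat.card F ^ (r * (r * d)) := by
    rw [Module.natCard_eq_pow_finrank (K := K), hcardK, finrank_quo hTmon, hTdeg, ← pow_mul]
  -- The choice of representative is harmless because T kills M; only the underlying function is
  -- needed for counting.
  let Φ : Quo T → Module.End E M := fun q => Module.toModuleEnd E M q.out
  have hΦ : ∀ (s : SkewPoly (frobq F K)) (m : M), Φ (Submodule.Quotient.mk s) m = s • m := by
    intro s m
    have h2 : (Submodule.Quotient.mk (Submodule.Quotient.mk s : Quo T).out : Quo T) =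
        Submodule.Quotient.mk s := Quotient.out_eq _
    rw [Submodule.Quotient.eq, mem_span_singleton_iff] at h2
    obtain ⟨g, hg⟩ := h2
    change (Submodule.Quotient.mk s : Quo T).out • m = s • m
    rw [← sub_eq_zero, ← sub_smul, hg, mul_smul, hTm, smul_zero]
  have hsurj : Function.Surjective Φ := by
    intro f
    obtain ⟨s, hs⟩ := exists_smul_eq_end_smul f
    exact ⟨Submodule.Quotient.mk s, LinearMap.ext fun m => (hΦ s m).trans (hs m)⟩
  have hle := Nat.card_le_card_of_surjective Φ hsurj
  rw [hcardT, hcardEnd, Nat.pow_le_pow_iff_right hq, mul_assoc] at hle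
  have h2 : n * μ ≤ r * d := Nat.le_of_mul_le_mul_left hle hr0
  refine ⟨?_, fun hnd s hs => ?_⟩
  · have h3 : r * (n * n) ≤ r * (d * d) := by
      calc r * (n * n) = n * (r * n) := by ring
        _ ≤ n * (d * μ) := Nat.mul_le_mul_left _ h1
        _ = d * (n * μ) := by ring
        _ ≤ d * (r * d) := Nat.mul_le_mul_left _ h2
        _ = r * (d * d) := by ring
    exact Nat.mul_self_le_mul_self_iff.1 (Nat.le_of_mul_le_mul_left h3 hr0)
  -- For n = d the two inequalities pinch μ to r, so source and target of Φ have the same size.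
  · have h3 : μ = r := by
      rw [← hnd, mul_comm] at h1
      rw [← hnd, mul_comm r] at h2
      exact le_antisymm (Nat.le_of_mul_le_mul_left h2 hn0) (Nat.le_of_mul_le_mul_left h1 hn0)
    have hbij : Function.Bijective Φ := by
      refine (Nat.bijective_iff_surjective_and_card Φ).2 ⟨hsurj, ?_⟩
      rw [hcardT, hcardEnd, h3, hnd, mul_assoc, mul_comm d]
    have h0 : (Submodule.Quotient.mk s : Quo T) = Submodule.Quotient.mk 0 := by
      refine hbij.1 (LinearMap.ext fun m => ?_)
      rw [hΦ, hΦ, hs, zero_smul]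
    exact quo_mk_eq_zero_iff.1 h0

/-- A simple module has dimension at most the degree of the minimal polynomial of `X ^ r`. -/
theorem finrank_le_natDegree_minpoly :
    Module.finrank K M ≤ (minpoly F (centralEnd (F := F) (K := K) M)).natDegree := by
  rcases X_smul_eq_zero_or_injective (σ := frobq F K) (M := M) with h | h
  · rw [finrank_eq_one_of_X_smul_eq_zero h]
    have := IsSimpleModule.nontrivial (SkewPoly (frobq F K)) M
    have : Finite M := Module.finite_of_finite K
    exact minpoly.natDegree_pos isIntegral_centralEnd
  · exact (finrank_le_and_annihilator h).1

end

end FiniteFields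

/-! ### Recovering a simple module from its annihilator. -/

/-- A simple module whose annihilator is generated by `T` is isomorphic to every
simple submodule of the quotient by `T`. -/
theorem nonempty_equiv_of_annihilator {K : Type*} [Field K] {σ : K →+* K} {T : SkewPoly σ}
    {M : Type*} [AddCommGroup M] [Module (SkewPoly σ) M] [IsSimpleModule (SkewPoly σ) M]
    (hT : ∀ m : M, T • m = 0)
    (hann : ∀ s : SkewPoly σ, (∀ m : M, s • m = 0) → ∃ g, s = g * T)
    (I : Submodule (SkewPoly σ) (Quo T)) [IsSimpleModule (SkewPoly σ) I] :
    Nonempty (I ≃ₗ[SkewPoly σ] M) := by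
  have := IsSimpleModule.nontrivial (SkewPoly σ) I
  obtain ⟨⟨x, hx⟩, hx0⟩ := exists_ne (0 : I)
  obtain ⟨s, rfl⟩ := Submodule.Quotient.mk_surjective _ x
  -- A nonzero class of s in I lies outside the annihilator, so s moves some m. Sending 1 to m is
  -- then nonzero on I, and Schur's lemma concludes.
  obtain ⟨m, hm⟩ : ∃ m : M, s • m ≠ 0 := by
    by_contra! hall
    exact hx0 (Subtype.ext (quo_mk_eq_zero_iff.2 (hann s hall)))
  let f : Quo T →ₗ[SkewPoly σ] M :=
    Submodule.liftQ _ (LinearMap.toSpanSingleton (SkewPoly σ) M m) <| by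
      rw [Submodule.span_singleton_le_iff_mem, LinearMap.mem_ker]
      exact hT m
  have hf : f.domRestrict I ≠ 0 := fun h0 => hm (LinearMap.congr_fun h0 ⟨_, hx⟩)
  exact ⟨LinearEquiv.ofBijective _ (LinearMap.bijective_of_ne_zero hf)⟩

/-- The class of 1 is killed by X, so P divides X on the right, and the quotient is a line, so P has
degree 1. This settles the case excluded from the count. -/
theorem eq_X_of_X_smul_eq_zero {K : Type*} [Field K] {σ : K →+* K} {P : SkewPoly σ} (hP : P.Monic)
    (h : Irreducible P) (hX : ∀ q : Quo P, X σ • q = 0) : P = X σ := by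
  obtain ⟨g, hg⟩ := quo_mk_eq_zero_iff.1 (hX (Submodule.Quotient.mk 1))
  replace hg : X σ = g * P := (mul_one _).symm.trans hg
  have := (isSimpleModule_quo_iff hP.ne_zero).2 h
  have hdeg := finrank_eq_one_of_X_smul_eq_zero hX
  rw [finrank_quo hP] at hdeg
  have hXd : (X σ).natDegree = 1 := by simpa using natDegree_X_pow (σ := σ) 1
  have hXm : (X σ).Monic := by
    rw [Monic, hXd]
    simp [X, coeff_monomial]
  have hgm : g.Monic := Monic.of_mul_right (hg ▸ hXm) hP
  have hg0 : g.natDegree = 0 := by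
    have := natDegree_mul hgm.ne_zero hP.ne_zero
    rw [← hg, hXd, hdeg] at this
    omega
  rw [hg, hgm.eq_one_of_isUnit ((isUnit_iff_natDegree_eq_zero hgm.ne_zero).2 hg0), one_mul]

/-! ### Irreducibility, classification and surjectivity of Ψ. -/

section FiniteFields

variable {F K : Type*} [Field F] [Fintype F] [Field K] [Algebra F K] [Finite K]

theorem finite_quo_of_monic {P : SkewPoly (frobq F K)} (hP : P.Monic) : Finite (Quo P) :=
  haveI := finite_quo hP
  Module.finite_of_finite K

theorem minpoly_centralEnd_dvd_Psi {P : SkewPoly (frobq F K)} (hP : P.Monic) :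
    minpoly F (centralEnd (F := F) (K := K) (Quo P)) ∣ P.Psi := by
  have := finite_quo hP
  refine minpoly.dvd _ _ (LinearMap.ext fun m => ?_)
  rw [aeval_centralEnd_eq_powEnd, map_Psi_eq_charpoly_powEnd hP, LinearMap.aeval_self_charpoly]
  rfl

/-- Cayley-Hamilton gives divisibility, and the dimension bound for simple modules forces equal
degrees. -/
theorem minpoly_centralEnd_eq_Psi {P : SkewPoly (frobq F K)} (hP : P.Monic) (h : Irreducible P) :
    minpoly F (centralEnd (F := F) (K := K) (Quo P)) = P.Psi := by
  have := finite_quo hP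
  have := finite_quo_of_monic hP
  have := (isSimpleModule_quo_iff hP.ne_zero).2 h
  refine (Polynomial.eq_of_monic_of_dvd_of_natDegree_le (minpoly.monic isIntegral_centralEnd)
    (Psi_monic P) (minpoly_centralEnd_dvd_Psi hP) ?_).symm
  rw [natDegree_Psi, ← finrank_quo hP]
  exact finrank_le_natDegree_minpoly

/-- Forwards, Ψ(P) is a minimal polynomial in a division ring. Backwards, Ψ is multiplicative and
preserves degree, so a factorization of P into non-units would give one of Ψ(P). -/
theorem irreducible_iff_irreducible_Psi {P : SkewPoly (frobq F K)} (hP : P.Monic) :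
    Irreducible P ↔ Irreducible P.Psi := by
  classical
  constructor
  · intro h
    have := finite_quo_of_monic hP
    have := (isSimpleModule_quo_iff hP.ne_zero).2 h
    rw [← minpoly_centralEnd_eq_Psi hP h]
    exact minpoly.irreducible isIntegral_centralEnd
  · intro h
    have hdeg {A : SkewPoly (frobq F K)} (hA : A.Monic) (hu : IsUnit A.Psi) : IsUnit A := by
      rw [isUnit_iff_natDegree_eq_zero hA.ne_zero, ← natDegree_Psi]
      exact Polynomial.natDegree_eq_zero_of_isUnit hu
    refine ⟨fun hu => ?_, fun A B hAB => ?_⟩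
    · have := (isUnit_iff_natDegree_eq_zero hP.ne_zero).1 hu
      rw [← natDegree_Psi] at this
      exact h.natDegree_pos.ne' this
    · have hB : B ≠ 0 := by rintro rfl; exact hP.ne_zero (by rw [hAB, mul_zero])
      obtain ⟨a, ha, hmon⟩ := exists_monic_C_mul hB
      have hu : IsUnit (C (frobq F K) a) := (isUnit_iff_ne_zero.2 ha).map _
      have huinv : IsUnit (C (frobq F K) a⁻¹) := (isUnit_iff_ne_zero.2 (inv_ne_zero ha)).map _
      -- Ψ is multiplicative on monic factors, so a constant is moved from one factor to the other.
      have hAB' : P = (A * C (frobq F K) a⁻¹) * (C (frobq F K) a * B) := by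
        rw [hAB, mul_assoc, ← mul_assoc (C (frobq F K) a⁻¹), ← map_mul, inv_mul_cancel₀ ha, map_one,
          one_mul]
      have hA : (A * C (frobq F K) a⁻¹).Monic := Monic.of_mul_right (hAB' ▸ hP) hmon
      rw [hAB', Psi_mul hA hmon] at h
      rcases h.isUnit_or_isUnit rfl with h' | h'
      · exact Or.inl ((Units.isUnit_mul_units A huinv.unit).1 (hdeg hA h'))
      · exact Or.inr ((Units.isUnit_units_mul hu.unit B).1 (hdeg hmon h'))

/-- If X kills `Quo P`, the minimal polynomial of X^r is Y, so X^r also kills `Quo Q`; then X is not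
injective there and must act by zero. -/
theorem X_smul_eq_zero_of_Psi_eq {P Q : SkewPoly (frobq F K)} (hP : P.Monic) (hQ : Q.Monic)
    (hPi : Irreducible P) (hQi : Irreducible Q) (h : P.Psi = Q.Psi)
    (hX : ∀ q : Quo P, X (frobq F K) • q = 0) (q : Quo Q) : X (frobq F K) • q = 0 := by
  have hr : Module.finrank F K ≠ 0 := Module.finrank_pos.ne'
  have := (isSimpleModule_quo_iff hP.ne_zero).2 hPi
  have := (isSimpleModule_quo_iff hQ.ne_zero).2 hQi
  have := IsSimpleModule.nontrivial (SkewPoly (frobq F K)) (Quo P)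
  have := IsSimpleModule.nontrivial (SkewPoly (frobq F K)) (Quo Q)
  have h0 : centralEnd (F := F) (K := K) (Quo P) = 0 := by
    refine LinearMap.ext fun m => ?_
    rw [centralEnd_apply, ← Nat.succ_pred_eq_of_ne_zero hr, pow_succ, mul_smul, hX, smul_zero]
    rfl
  have hΨ : Q.Psi = Polynomial.X := by
    rw [← h, ← minpoly_centralEnd_eq_Psi hP hPi, h0, minpoly.zero]
  have hQ0 : centralEnd (F := F) (K := K) (Quo Q) = 0 := by
    have := minpoly.aeval F (centralEnd (F := F) (K := K) (Quo Q))
    rwa [minpoly_centralEnd_eq_Psi hQ hQi, hΨ, Polynomial.aeval_X] at this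
  rcases X_smul_eq_zero_or_injective (σ := frobq F K) (M := Quo Q) with h1 | h1
  · exact h1 q
  · exfalso
    have hinj : ∀ n : ℕ, ∀ m : Quo Q, X (frobq F K) ^ n • m = 0 → m = 0 := by
      intro n
      induction n with
      | zero => intro m hm; simpa using hm
      | succ n ih =>
        intro m hm
        rw [pow_succ, mul_smul] at hm
        exact h1 ((ih _ hm).trans (smul_zero _).symm)
    obtain ⟨m, hm⟩ := exists_ne (0 : Quo Q)
    exact hm (hinj _ m (LinearMap.congr_fun hQ0 m))

/-- If X kills one quotient, both polynomials equal X. Otherwise both quotients have annihilator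
generated by T = Ψ(P)(X^r), and both are isomorphic to one simple submodule of the finite module
`Quo T`. -/
theorem nonempty_quo_equiv_of_Psi_eq {P Q : SkewPoly (frobq F K)} (hP : P.Monic) (hQ : Q.Monic)
    (hPi : Irreducible P) (hQi : Irreducible Q) (h : P.Psi = Q.Psi) :
    Nonempty (Quo Q ≃ₗ[SkewPoly (frobq F K)] Quo P) := by
  have := finite_quo hP
  have := finite_quo hQ
  have := (isSimpleModule_quo_iff hP.ne_zero).2 hPi
  have := (isSimpleModule_quo_iff hQ.ne_zero).2 hQi
  rcases X_smul_eq_zero_or_injective (σ := frobq F K) (M := Quo P) with h1 | h1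
  · have h2 := X_smul_eq_zero_of_Psi_eq hP hQ hPi hQi h h1
    rw [eq_X_of_X_smul_eq_zero hP hPi h1, eq_X_of_X_smul_eq_zero hQ hQi h2]
    exact ⟨LinearEquiv.refl _ _⟩
  rcases X_smul_eq_zero_or_injective (σ := frobq F K) (M := Quo Q) with h2 | h2
  · have h1 := X_smul_eq_zero_of_Psi_eq hQ hP hQi hPi h.symm h2
    rw [eq_X_of_X_smul_eq_zero hP hPi h1, eq_X_of_X_smul_eq_zero hQ hQi h2]
    exact ⟨LinearEquiv.refl _ _⟩
  have hannP := (finrank_le_and_annihilator (F := F) (K := K) h1).2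
  have hannQ := (finrank_le_and_annihilator (F := F) (K := K) h2).2
  have haP := minpoly.aeval F (centralEnd (F := F) (K := K) (Quo P))
  have haQ := minpoly.aeval F (centralEnd (F := F) (K := K) (Quo Q))
  rw [minpoly_centralEnd_eq_Psi hP hPi] at hannP haP
  rw [minpoly_centralEnd_eq_Psi hQ hQi, ← h] at hannQ haQ
  replace hannP := hannP (by rw [finrank_quo hP, natDegree_Psi])
  replace hannQ := hannQ (by rw [finrank_quo hQ, h, natDegree_Psi])
  obtain ⟨hTdeg, hTmon⟩ := natDegree_monic_aeval_X_pow (K := K) (Psi_monic P)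
  have hTP : ∀ m : Quo P, Polynomial.aeval (X (frobq F K) ^ Module.finrank F K) P.Psi • m = 0 :=
    fun m => by rw [← aeval_centralEnd_apply, haP, LinearMap.zero_apply]
  have hTQ : ∀ m : Quo Q, Polynomial.aeval (X (frobq F K) ^ Module.finrank F K) P.Psi • m = 0 :=
    fun m => by rw [← aeval_centralEnd_apply, haQ, LinearMap.zero_apply]
  set T := Polynomial.aeval (X (frobq F K) ^ Module.finrank F K) P.Psi
  have := finite_quo_of_monic hTmon
  have : Finite (Submodule (SkewPoly (frobq F K)) (Quo T)) :=
    Finite.of_injective _ SetLike.coe_injective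
  have hTu : ¬ IsUnit T := by
    have := ((irreducible_iff_irreducible_Psi hP).1 hPi).natDegree_pos
    rw [isUnit_iff_natDegree_eq_zero hTmon.ne_zero, hTdeg]
    exact (Nat.mul_pos Module.finrank_pos this).ne'
  have : Nontrivial (Quo T) :=
    Submodule.Quotient.nontrivial_iff.2 fun ht => hTu (span_eq_top_iff.1 ht)
  obtain ⟨I, hI⟩ := IsAtomic.exists_atom (Submodule (SkewPoly (frobq F K)) (Quo T))
  have := isSimpleModule_iff_isAtom.2 hI
  obtain ⟨eP⟩ := nonempty_equiv_of_annihilator hTP hannP I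
  obtain ⟨eQ⟩ := nonempty_equiv_of_annihilator hTQ hannQ I
  exact ⟨eQ.symm.trans eP⟩

theorem exists_Psi_eq_of_irreducible {R : Polynomial F} (hR : R.Monic) (hRi : Irreducible R) :
    ∃ P : SkewPoly (frobq F K), P.Monic ∧ P.Psi = R := by
  obtain ⟨hTdeg, hTmon⟩ := natDegree_monic_aeval_X_pow (K := K) hR
  set T := Polynomial.aeval (X (frobq F K) ^ Module.finrank F K) R with hT
  have hTu : ¬ IsUnit T := by
    rw [isUnit_iff_natDegree_eq_zero hTmon.ne_zero, hTdeg]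
    exact (Nat.mul_pos Module.finrank_pos hRi.natDegree_pos).ne'
  -- A generator P of a maximal left ideal above T is irreducible.
  obtain ⟨I, hI, hle⟩ := Ideal.exists_le_maximal (Submodule.span (SkewPoly (frobq F K)) {T})
    fun ht => hTu (span_eq_top_iff.1 ht)
  have hIne : I ≠ ⊥ := by
    rintro rfl
    exact hTmon.ne_zero (Submodule.span_singleton_eq_bot.1 (le_bot_iff.1 hle))
  obtain ⟨P, hP, rfl⟩ := exists_monic_span hIne
  obtain ⟨V, hV⟩ := span_le_span_iff.1 hle
  have hsimple : IsSimpleModule (SkewPoly (frobq F K)) (Quo P) :=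
    isSimpleModule_iff_isCoatom.2 hI.out
  have hPi := (isSimpleModule_quo_iff hP.ne_zero).1 hsimple
  have := finite_quo_of_monic hP
  refine ⟨P, hP, ?_⟩
  have hdvd : minpoly F (centralEnd (F := F) (K := K) (Quo P)) ∣ R := by
    refine minpoly.dvd _ _ (LinearMap.ext fun m => ?_)
    obtain ⟨f, rfl⟩ := Submodule.Quotient.mk_surjective _ m
    -- Since T is central and a left multiple of P, it kills all of `Quo P`, not merely the class of
    -- 1.
    rw [aeval_centralEnd_apply, ← Submodule.Quotient.mk_smul, smul_eq_mul,
      (commute_aeval_X_pow R f).eq]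
    exact quo_mk_eq_zero_iff.2 ⟨f * V, by rw [← hT, hV, mul_assoc]⟩
  rw [minpoly_centralEnd_eq_Psi hP hPi] at hdvd
  exact Polynomial.eq_of_monic_of_associated (Psi_monic P) hR
    (((irreducible_iff_irreducible_Psi hP).1 hPi).associated_of_dvd hRi hdvd)

theorem Psi_one : (1 : SkewPoly (frobq F K)).Psi = 1 := by
  refine (Psi_monic _).natDegree_eq_zero.1 ?_
  rw [natDegree_Psi, ← map_one (C (frobq F K)), natDegree_C]

theorem exists_Psi_eq {R : Polynomial F} (hR : R.Monic) :
    ∃ P : SkewPoly (frobq F K), P.Monic ∧ P.Psi = R := by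
  induction hn : R.natDegree using Nat.strong_induction_on generalizing R with
  | _ n ih =>
    by_cases hu : IsUnit R
    · refine ⟨1, ?_, ?_⟩
      · have h0 : (1 : SkewPoly (frobq F K)).natDegree = 0 := by
          rw [← map_one (C (frobq F K)), natDegree_C]
        rw [Monic, h0, coeff_one, if_pos rfl]
      · rw [Psi_one, hR.eq_one_of_isUnit hu]
    · obtain ⟨R₁, hm, hi, R₂, rfl⟩ := Polynomial.exists_monic_irreducible_factor R hu
      have hm₂ : R₂.Monic := hm.of_mul_monic_left hR
      have hlt : R₂.natDegree < n := by
        rw [← hn, hm.natDegree_mul hm₂]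
        have := hi.natDegree_pos
        omega
      obtain ⟨P₁, hP₁, h₁⟩ := exists_Psi_eq_of_irreducible (K := K) hm hi
      obtain ⟨P₂, hP₂, h₂⟩ := ih _ hlt hm₂ rfl
      exact ⟨P₁ * P₂, hP₁.mul hP₂, by rw [Psi_mul hP₁ hP₂, h₁, h₂]⟩

end FiniteFields

end SkewPoly

end

theorem mainTheorem9 {F K : Type*} [Field F] [Fintype F] [Field K] [Finite K] [Algebra F K] :
    (∀ P Q : SkewPoly (frobq F K), P.Monic → Q.Monic → Irreducible P →
      (P.Similar Q ↔ P.Psi = Q.Psi)) ∧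
    (∀ P : SkewPoly (frobq F K), P.Monic → (Irreducible P ↔ Irreducible P.Psi)) ∧
    (SkewPoly.Psi '' {P : SkewPoly (frobq F K) | P.Monic} = {R : Polynomial F | R.Monic}) := by
  refine ⟨fun P Q hP hQ hPi => ?_, fun P hP => SkewPoly.irreducible_iff_irreducible_Psi hP, ?_⟩
  · rw [SkewPoly.similar_iff_nonempty_quo_equiv hP.ne_zero hPi.not_isUnit]
    refine ⟨fun ⟨e⟩ => SkewPoly.Psi_eq_of_equiv hP hQ e, fun h => ?_⟩
    -- Irreducibility of Q is not assumed; it passes from P through the common value of Ψ.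
    have hQi : Irreducible Q := by
      rw [SkewPoly.irreducible_iff_irreducible_Psi hQ, ← h]
      exact (SkewPoly.irreducible_iff_irreducible_Psi hP).1 hPi
    exact SkewPoly.nonempty_quo_equiv_of_Psi_eq hP hQ hPi hQi h
  · refine Set.Subset.antisymm ?_ fun R hR => SkewPoly.exists_Psi_eq hR
    rintro _ ⟨P, -, rfl⟩
    exact SkewPoly.Psi_monic P
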